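/- A temporal graph $\mathcal G=(V,\mathcal E,T)$ consists of a finite vertex set $V$, a maximum time label $T$ and a set $\mathcal E\subseteq\binom V2\times\{1,\dots,T\}$ of time edges; its underlying graph has as edges all $\{u,v\}$ with $(\{u,v\},t)\in\mathcal E$ for some $t$. It is *happy* if every underlying edge has exactly one label and any two distinct edges that share an endpoint have different labels. A (strict) temporal path is a path of the underlying graph with a label chosen for each of its edges, each giving a time edge of $\mathcal G$, such that the labels are non-decreasing (increasing) along the path; $\mathcal G$ is (strictly) temporally connected if there is a (strict) temporal path between every ordered pair of vertices. A temporal spanner of $\mathcal G$ is a (strictly) temporally connected temporal graph $(V,\mathcal E',T')$ with $\mathcal E'\subseteq\mathcal E$ and $T'\le T$. The problem Minimum Temporal Spanner asks, given a (strictly) temporally connected temporal graph $\mathcal G$ and a non-negative integer $k$, whether $\mathcal G$ has a temporal spanner with $|\mathcal E'|\le k$. **Theorem 2.** In both the strict and the non-strict setting, Minimum Temporal Spanner restricted to happy temporal graphs is in XP when parameterized by the vertex cover number $d$ of the underlying graph: it is solved by an algorithm with running time at most $f(d)\cdot L^{f(d)}$ for some computable function $f$, where $L$ is the input size in bits. More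 precisely, it can be solved in time $n^{O(d^2)}$, where $n=|V|$: there are a single algorithm and a constant $C$ such that the algorithm decides every such instance in at most $C\cdot n^{C d^2}$ steps (with $0^0=1$) of a random access machine whose arithmetic operations are addition and truncated subtraction and whose elementary operations, on integers of any size, take one step each. -/

import Mathlib

/-! ### Temporal graphs -/

/-- A temporal graph `(V, 𝓔, T)`: a finite set of time edges, i.e. pairs of a two-element
subset of `V` and a label in `{1, …, T}`, and a maximum time label `T`. -/
structure TemporalGraph (V : Type) where
  timeEdges : Finset (Sym2 V × ℕ)
  maxLabel : ℕ
  not_isDiag : ∀ e t, (e, t) ∈ timeEdges → ¬ e.IsDiag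
  one_le_label : ∀ e t, (e, t) ∈ timeEdges → 1 ≤ t
  label_le : ∀ e t, (e, t) ∈ timeEdges → t ≤ maxLabel

/-- The two variants of temporal paths: labels increase, or labels do not decrease. -/
inductive PathKind
  | strict
  | nonStrict

/-- The relation required between the labels of a temporal path. -/
def PathKind.Rel : PathKind → ℕ → ℕ → Prop
  | .strict => (· < ·)
  | .nonStrict => (· ≤ ·)

namespace TemporalGraph

variable {V : Type}

/-- The underlying static graph. -/
def underlying (G : TemporalGraph V) : SimpleGraph V where
  Adj u v := ∃ t, (s(u, v), t) ∈ G.timeEdges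
  symm := ⟨fun u v ⟨t, h⟩ => ⟨t, by rwa [Sym2.eq_swap]⟩⟩
  loopless := ⟨fun u ⟨t, h⟩ => G.not_isDiag _ _ h (Sym2.mk_isDiag_iff.2 rfl)⟩

/-- Every edge has at most one label. -/
def IsSimple (G : TemporalGraph V) : Prop :=
  ∀ e t t', (e, t) ∈ G.timeEdges → (e, t') ∈ G.timeEdges → t = t'

/-- Distinct edges that share an endpoint never carry the same label. -/
def IsProper (G : TemporalGraph V) : Prop :=
  ∀ e t e' t', (e, t) ∈ G.timeEdges → (e', t') ∈ G.timeEdges → e ≠ e' →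
    (∃ v, v ∈ e ∧ v ∈ e') → t ≠ t'

/-- Simple and proper. -/
def IsHappy (G : TemporalGraph V) : Prop :=
  G.IsSimple ∧ G.IsProper

/-- There is a (strict or non-strict) temporal path from `u` to `v`: a path of the underlying
graph and one label for each of its edges, in order, each giving a time edge, such that the
sequence of labels is increasing (resp. non-decreasing). -/
def Reaches (κ : PathKind) (G : TemporalGraph V) (u v : V) : Prop :=
  ∃ p : G.underlying.Walk u v, p.IsPath ∧
    ∃ ts : List ℕ, List.Forall₂ (fun e t => (e, t) ∈ G.timeEdges) p.edges ts ∧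
      ts.Pairwise κ.Rel

/-- Temporal connectivity: the class `TC`, resp. `strict-TC`. -/
def IsTC (κ : PathKind) (G : TemporalGraph V) : Prop :=
  ∀ u v, G.Reaches κ u v

/-- `H` is a temporal spanner of `G`. -/
def IsSpanner (κ : PathKind) (H G : TemporalGraph V) : Prop :=
  H.timeEdges ⊆ G.timeEdges ∧ H.maxLabel ≤ G.maxLabel ∧ H.IsTC κ

end TemporalGraph

/-! ### The machine model

A random access machine, programmed by structured programs with finitely many integer
variables and finitely many integer arrays. The arithmetic operations are addition and
truncated subtraction only; every elementary operation, array access and test takes one step.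
-/

/-- Expressions. -/
inductive RamExpr
  | const (c : ℕ)
  | var (x : ℕ)
  | get (a : ℕ) (i : RamExpr)
  | plus (e₁ e₂ : RamExpr)
  | minus (e₁ e₂ : RamExpr)

/-- Programs. -/
inductive RamProg
  | skip
  | assign (x : ℕ) (e : RamExpr)
  | put (a : ℕ) (i e : RamExpr)
  | seq (p q : RamProg)
  | cond (e : RamExpr) (p q : RamProg)
  | loop (e : RamExpr) (p : RamProg)

/-- The contents of the variables and of the arrays. -/
structure RamState where
  var : ℕ → ℕ
  arr : ℕ → ℕ → ℕ

/-- The value of an expression. -/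
def RamExpr.eval (σ : RamState) : RamExpr → ℕ
  | .const c => c
  | .var x => σ.var x
  | .get a i => σ.arr a (i.eval σ)
  | .plus e₁ e₂ => e₁.eval σ + e₂.eval σ
  | .minus e₁ e₂ => e₁.eval σ - e₂.eval σ

/-- The number of steps that the evaluation of an expression takes. -/
def RamExpr.cost : RamExpr → ℕ
  | .const _ => 1
  | .var _ => 1
  | .get _ i => i.cost + 1
  | .plus e₁ e₂ => e₁.cost + e₂.cost + 1
  | .minus e₁ e₂ => e₁.cost + e₂.cost + 1

/-- Assignment to a variable. -/
def RamState.setVar (σ : RamState) (x v : ℕ) : RamState :=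
  ⟨Function.update σ.var x v, σ.arr⟩

/-- Assignment to an array cell. -/
def RamState.setArr (σ : RamState) (a i v : ℕ) : RamState :=
  ⟨σ.var, Function.update σ.arr a (Function.update (σ.arr a) i v)⟩

/-- `RamExec p σ σ' t`: the program `p`, started in `σ`, halts in `σ'` after exactly `t` steps.
Tests succeed on nonzero values. -/
inductive RamExec : RamProg → RamState → RamState → ℕ → Prop
  | skip (σ : RamState) : RamExec .skip σ σ 1
  | assign (σ : RamState) (x : ℕ) (e : RamExpr) :
      RamExec (.assign x e) σ (σ.setVar x (e.eval σ)) (e.cost + 1)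
  | put (σ : RamState) (a : ℕ) (i e : RamExpr) :
      RamExec (.put a i e) σ (σ.setArr a (i.eval σ) (e.eval σ)) (i.cost + e.cost + 1)
  | seq {p q : RamProg} {σ σ' σ'' : RamState} {t t' : ℕ} :
      RamExec p σ σ' t → RamExec q σ' σ'' t' → RamExec (.seq p q) σ σ'' (t + t')
  | condTrue {e : RamExpr} {p q : RamProg} {σ σ' : RamState} {t : ℕ} :
      e.eval σ ≠ 0 → RamExec p σ σ' t → RamExec (.cond e p q) σ σ' (e.cost + 1 + t)
  | condFalse {e : RamExpr} {p q : RamProg} {σ σ' : RamState} {t : ℕ} :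
      e.eval σ = 0 → RamExec q σ σ' t → RamExec (.cond e p q) σ σ' (e.cost + 1 + t)
  | loopDone {e : RamExpr} {p : RamProg} {σ : RamState} :
      e.eval σ = 0 → RamExec (.loop e p) σ σ (e.cost + 1)
  | loopStep {e : RamExpr} {p : RamProg} {σ σ' σ'' : RamState} {t t' : ℕ} :
      e.eval σ ≠ 0 → RamExec p σ σ' t → RamExec (.loop e p) σ' σ'' t' →
        RamExec (.loop e p) σ σ'' (e.cost + 1 + t + t')

/-- The model is deterministic: final state and number of steps are determined. -/
theorem RamExec.unique {p : RamProg} {σ σ₁ σ₂ : RamState} {t₁ t₂ : ℕ}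
    (h₁ : RamExec p σ σ₁ t₁) (h₂ : RamExec p σ σ₂ t₂) : σ₁ = σ₂ ∧ t₁ = t₂ := by
  induction h₁ generalizing σ₂ t₂ with
  | skip | assign | put => cases h₂; exact ⟨rfl, rfl⟩
  | seq _ _ ih ih' =>
    cases h₂ with
    | seq a b => obtain ⟨rfl, rfl⟩ := ih a; obtain ⟨rfl, rfl⟩ := ih' b; exact ⟨rfl, rfl⟩
  | condTrue h _ ih =>
    cases h₂ with
    | condTrue _ a => obtain ⟨rfl, rfl⟩ := ih a; exact ⟨rfl, rfl⟩
    | condFalse h' _ => exact absurd h' h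
  | condFalse h _ ih =>
    cases h₂ with
    | condTrue h' _ => exact absurd h h'
    | condFalse _ a => obtain ⟨rfl, rfl⟩ := ih a; exact ⟨rfl, rfl⟩
  | loopDone h =>
    cases h₂ with
    | loopDone _ => exact ⟨rfl, rfl⟩
    | loopStep h' _ _ => exact absurd h h'
  | loopStep h _ _ ih ih' =>
    cases h₂ with
    | loopDone h' => exact absurd h' h
    | loopStep _ a b => obtain ⟨rfl, rfl⟩ := ih a; obtain ⟨rfl, rfl⟩ := ih' b; exact ⟨rfl, rfl⟩

/-- The initial state on input `w`: array `0` holds `w`, variable `0` holds its length, and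
everything else is zero. -/
def ramInit (w : List ℕ) : RamState where
  var x := if x = 0 then w.length else 0
  arr a i := if a = 0 then w.getD i 0 else 0

/-- The size in bits of a sequence of integers in binary, with separators. -/
def bitSize (w : List ℕ) : ℕ :=
  (w.map fun a => a.size + 1).sum

/-! ### Parameterized problems and XP -/

/-- A parameterized decision problem: instances, the integer sequences that represent an
instance, the yes-instances, and the parameter. -/
structure ParamProblem where
  Inst : Type
  Encodes : Inst → List ℕ → Prop
  Yes : Inst → Prop
  param : Inst → ℕ

/-- One program halts on every representation of every instance within the time bound and
leaves in variable `0` the answer: `1` on yes-instances, `0` on no-instances. -/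
def ParamProblem.SolvableInTime (Q : ParamProblem) (τ : Q.Inst → List ℕ → ℕ) : Prop :=
  ∃ p : RamProg, ∀ (I : Q.Inst) (w : List ℕ), Q.Encodes I w →
    ∃ (σ : RamState) (t : ℕ), RamExec p (ramInit w) σ t ∧ t ≤ τ I w ∧
      (Q.Yes I → σ.var 0 = 1) ∧ (¬ Q.Yes I → σ.var 0 = 0)

/-- The class XP: solvable in time `f(κ) · |w| ^ f(κ)` for some computable `f`, where `κ` is
the parameter and `|w|` the size of the input. -/
def ParamProblem.InXP (Q : ParamProblem) : Prop :=
  ∃ f : ℕ → ℕ, Computable f ∧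
    Q.SolvableInTime fun I w => f (Q.param I) * bitSize w ^ f (Q.param I)

/-! ### Minimum Temporal Spanner on happy temporal graphs -/

/-- An instance: a happy, temporally connected graph on the vertices `0, …, n - 1`, and the
bound `k` on the number of time edges of the spanner. -/
structure HappyInstance (κ : PathKind) where
  n : ℕ
  graph : TemporalGraph (Fin n)
  k : ℕ
  happy : graph.IsHappy
  connected : graph.IsTC κ

/-- Some temporal spanner has at most `k` time edges. -/
def HappyInstance.HasSmallSpanner {κ : PathKind} (I : HappyInstance κ) : Prop :=
  ∃ H : TemporalGraph (Fin I.n), H.IsSpanner κ I.graph ∧ H.timeEdges.card ≤ I.k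

/-- The sequence `n, T, k` followed by `u, v, t` for every time edge `({u, v}, t)`, each listed
once, in any order and with its endpoints in any order. -/
def HappyInstance.Encodes {κ : PathKind} (I : HappyInstance κ) (w : List ℕ) : Prop :=
  ∃ es : List (Fin I.n × Fin I.n × ℕ),
    (es.map fun e => (s(e.1, e.2.1), e.2.2)).Nodup ∧
    (∀ e t, (e, t) ∈ I.graph.timeEdges ↔ (e, t) ∈ es.map fun e => (s(e.1, e.2.1), e.2.2)) ∧
    w = I.n :: I.graph.maxLabel :: I.k ::
      es.flatMap fun e => [(e.1 : ℕ), (e.2.1 : ℕ), e.2.2]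

/-- Minimum Temporal Spanner on happy temporal graphs, parameterized by the vertex cover number
of the underlying graph. -/
noncomputable def happyMinimumTemporalSpanner (κ : PathKind) : ParamProblem where
  Inst := HappyInstance κ
  Encodes I w := I.Encodes w
  Yes I := I.HasSmallSpanner
  param I := I.graph.underlying.vertexCoverNum.toNat

/-! Properness makes consecutive labels on a path distinct, so strict and non-strict connectivity
coincide, and both can be expressed by `Journey`, that is, by walks with increasing labels
(`isTC_iff_connects`). What remains is to look for a small connecting set of time edges
(`hasSmallSpanner_iff`).

Let `X` be a vertex cover of size `d` and `E` a connecting set; at a vertex outside `X`, every edge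
leads into `X`. For `x ∈ X` let `τ x` be the largest label of an edge to `x` that is the first edge
of some vertex outside `X`. The vertex attaining it reaches everything, hence so does `x` from time
`τ x` on (`Journey.of_first`), and all other vertices with first edge to `x` arrive there in time.
Dually, `θ y` is the smallest label of a last edge joining a vertex outside `X` to `y`
(`Journey.of_last`). This gives sets `P` of departure points and `Q` of arrival points, with at most
`2d` elements each. Foremost journeys meet `X` at least every second step, so from each departure
point a tree of at most `2d` edges reaches all of `X` (`exists_foremost_tree`); the union `F` of
these trees has at most `4d²` edges and links all of `P` to all of `Q`.

Given `F`, `P`, `Q`, each vertex can be attached on its own, by at most two further edges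
(`missing`). Outside `X`, the set `E` pays at least as much at each vertex, and the edge sets at
these vertices are disjoint, so the core together with the missing edges is no larger than `E`
(`Connects.exists_core`). Conversely, every core completed in this way connects
(`SpannerCore.exists_connects`). So it suffices to try all triples `(F, P, Q)`.

For input length `L`, lists are coded as numbers in base `L + 2` below the bound `(L + 2) ^ (4 (D +
1)²)`, and the search loops over all codes. Since the machine cannot multiply, a calculus of `Easy`
functions shows that everything built from loops of that length takes time polynomial in the bound.
As `d` is not given, `exists_search_program` raises `D` until a vertex cover of size at most `D`
turns up. Simple graphs have at most `n²` time edges, so `L` is `O(n²)` and the total time is `n ^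
O(d²)`. -/

/-! ### Functions computable in time polynomial in a loop bound -/

/-- The part of a state that the subroutines read: array `0`, and the variables `0`, `1`, `2`, of
which variable `1` bounds the number of iterations of every loop. -/
structure RamInput where
  arr : ℕ → ℕ
  len : ℕ
  bound : ℕ
  level : ℕ

/-- The input data of a state. -/
def RamState.input (σ : RamState) : RamInput :=
  ⟨σ.arr 0, σ.var 0, σ.var 1, σ.var 2⟩

/-- `σ'` has the same arrays as `σ`, and the same variables below `r`. -/
def RamState.Keeps (r : ℕ) (σ σ' : RamState) : Prop :=
  σ'.arr = σ.arr ∧ ∀ i < r, σ'.var i = σ.var i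

theorem RamState.Keeps.refl (r : ℕ) (σ : RamState) : RamState.Keeps r σ σ :=
  ⟨rfl, fun _ _ => rfl⟩

theorem RamState.Keeps.trans {r r' : ℕ} {σ σ' σ'' : RamState} (h : RamState.Keeps r σ σ')
    (h' : RamState.Keeps r' σ' σ'') (hr : r ≤ r') : RamState.Keeps r σ σ'' :=
  ⟨h'.1.trans h.1, fun i hi => (h'.2 i (hi.trans_le hr)).trans (h.2 i hi)⟩

theorem RamState.keeps_setVar {r x : ℕ} (σ : RamState) (v : ℕ) (h : r ≤ x) :
    RamState.Keeps r σ (σ.setVar x v) :=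
  ⟨rfl, fun _ hi => Function.update_of_ne (hi.trans_le h).ne _ _⟩

@[simp]
theorem RamState.setVar_var_self (σ : RamState) (x v : ℕ) : (σ.setVar x v).var x = v :=
  Function.update_self ..

theorem RamState.setVar_var_of_ne (σ : RamState) {x y : ℕ} (v : ℕ) (h : y ≠ x) :
    (σ.setVar x v).var y = σ.var y :=
  Function.update_of_ne h ..

/-- A type whose elements can be stored in finitely many registers: `Reads r ℓ` says that `ℓ` reads
an element off the registers below `r`. -/
class RamContext (Γ : Type) where
  Reads : ℕ → (RamState → Γ) → Prop
  mono : ∀ {r r' : ℕ} {l : RamState → Γ}, r ≤ r' → Reads r l → Reads r' l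
  keeps : ∀ {r : ℕ} {l : RamState → Γ} {σ σ' : RamState}, 3 ≤ r → Reads r l →
    RamState.Keeps r σ σ' → l σ' = l σ

/-- The input has one fixed location, array `0` and variables `0`, `1`, `2`. It survives every
subroutine that works on registers from `3` upwards. -/
instance : RamContext RamInput where
  Reads _ l := l = RamState.input
  mono _ h := h
  keeps := by
    rintro r l σ σ' hr rfl ⟨h, h'⟩
    simp [RamState.input, h, h' 0 (by omega), h' 1 (by omega), h' 2 (by omega)]

instance : RamContext ℕ where
  Reads r l := ∃ j < r, l = fun σ => σ.var j
  mono := fun hr ⟨j, hj, e⟩ => ⟨j, hj.trans_le hr, e⟩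
  keeps := by
    rintro r _ σ σ' _ ⟨j, hj, rfl⟩ h
    exact h.2 j hj

instance {Γ Δ : Type} [RamContext Γ] [RamContext Δ] : RamContext (Γ × Δ) where
  Reads r l := RamContext.Reads r (fun σ => (l σ).1) ∧ RamContext.Reads r (fun σ => (l σ).2)
  mono hr h := ⟨RamContext.mono hr h.1, RamContext.mono hr h.2⟩
  keeps hr h hk := Prod.ext (RamContext.keeps hr h.1 hk) (RamContext.keeps hr h.2 hk)

/-- The time bounds of the subroutines. -/
def polyTime (c M : ℕ) : ℕ := c * (M + 1) ^ c

/-- Using one constant as both factor and exponent closes these bounds under sums and, by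
`mul_polyTime_le`, under loops of length `M`. -/
theorem polyTime_add_le (c c' M : ℕ) : polyTime c M + polyTime c' M ≤ polyTime (c + c') M := by
  have h₁ : (M + 1) ^ c ≤ (M + 1) ^ (c + c') := Nat.pow_le_pow_right (by omega) (by omega)
  have h₂ : (M + 1) ^ c' ≤ (M + 1) ^ (c + c') := Nat.pow_le_pow_right (by omega) (by omega)
  unfold polyTime
  nlinarith

theorem le_polyTime (c M : ℕ) : c ≤ polyTime c M :=
  Nat.le_mul_of_pos_right _ (by positivity)

theorem polyTime_mono_right (c : ℕ) {M M' : ℕ} (h : M ≤ M') : polyTime c M ≤ polyTime c M' :=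
  Nat.mul_le_mul_left _ (Nat.pow_le_pow_left (by omega) _)

theorem mul_polyTime_le (c M : ℕ) : M * polyTime c M ≤ polyTime (c + 1) M := by
  unfold polyTime
  rw [pow_succ]
  have : 0 < (M + 1) ^ c := by positivity
  nlinarith [Nat.zero_le (c * (M + 1) ^ c), Nat.zero_le (M * (M + 1) ^ c)]

/-- `g` is computed by a program in time polynomial in the loop bound. -/
def Easy {Γ Δ : Type} [RamContext Γ] [RamContext Δ] (g : Γ → Δ) : Prop :=
  ∀ (r : ℕ) (l : RamState → Γ), 3 ≤ r → RamContext.Reads r l →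
    ∃ (p : RamProg) (c r' : ℕ) (l' : RamState → Δ), r ≤ r' ∧ RamContext.Reads r' l' ∧
      ∀ σ, ∃ (σ' : RamState) (t : ℕ), RamExec p σ σ' t ∧ t ≤ polyTime c (σ.var 1) ∧
        RamState.Keeps r σ σ' ∧ l' σ' = g (l σ)

/-- Total correctness of a loop that is executed exactly `N` times. -/
theorem RamExec.exists_loop {e : RamExpr} {p : RamProg} (N T : ℕ) (Inv : ℕ → RamState → Prop)
    (hstep : ∀ i < N, ∀ σ, Inv i σ →
      e.eval σ ≠ 0 ∧ ∃ σ' t, RamExec p σ σ' t ∧ t ≤ T ∧ Inv (i + 1) σ')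
    (hdone : ∀ σ, Inv N σ → e.eval σ = 0) {σ : RamState} (h0 : Inv 0 σ) :
    ∃ σ' t, RamExec (.loop e p) σ σ' t ∧ t ≤ N * (T + e.cost + 1) + (e.cost + 1) ∧ Inv N σ' := by
  suffices H : ∀ k i σ, i + k = N → Inv i σ →
      ∃ σ' t, RamExec (.loop e p) σ σ' t ∧ t ≤ k * (T + e.cost + 1) + (e.cost + 1) ∧ Inv N σ' from
    H N 0 σ (by omega) h0
  intro k
  induction k with
  | zero =>
    rintro i σ rfl h
    exact ⟨σ, _, .loopDone (hdone σ h), by simp, h⟩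
  | succ k ih =>
    intro i σ hi h
    obtain ⟨he, σ₁, t₁, ex₁, ht₁, h₁⟩ := hstep i (by omega) σ h
    obtain ⟨σ₂, t₂, ex₂, ht₂, h₂⟩ := ih (i + 1) σ₁ (by omega) h₁
    refine ⟨σ₂, _, .loopStep he ex₁ ex₂, ?_, h₂⟩
    rw [Nat.succ_mul]
    omega

/-! ### Composition, arithmetic and bounded recursion of easy functions -/

section Closure

variable {Γ Δ Θ : Type} [RamContext Γ] [RamContext Δ] [RamContext Θ]

/-- The second program is placed above the registers from which the intermediate value is read, so
nothing it needs is overwritten. -/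
theorem Easy.comp {g : Δ → Θ} {f : Γ → Δ} (hg : Easy g) (hf : Easy f) :
    Easy fun x => g (f x) := by
  intro r l hr hl
  obtain ⟨p, c, r₁, l₁, hr₁, hl₁, H₁⟩ := hf r l hr hl
  obtain ⟨q, c', r₂, l₂, hr₂, hl₂, H₂⟩ := hg r₁ l₁ (by omega) hl₁
  refine ⟨.seq p q, c + c', r₂, l₂, by omega, hl₂, fun σ => ?_⟩
  obtain ⟨σ₁, t₁, e₁, ht₁, k₁, v₁⟩ := H₁ σ
  obtain ⟨σ₂, t₂, e₂, ht₂, k₂, v₂⟩ := H₂ σ₁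
  refine ⟨σ₂, _, .seq e₁ e₂, ?_, k₁.trans k₂ hr₁, by rw [v₂, v₁]⟩
  rw [k₁.2 1 (by omega)] at ht₂
  exact (Nat.add_le_add ht₁ ht₂).trans (polyTime_add_le ..)

theorem Easy.prodMk {f : Γ → Δ} {g : Γ → Θ} (hf : Easy f) (hg : Easy g) :
    Easy fun x => (f x, g x) := by
  intro r l hr hl
  obtain ⟨p, c, r₁, l₁, hr₁, hl₁, H₁⟩ := hf r l hr hl
  obtain ⟨q, c', r₂, l₂, hr₂, hl₂, H₂⟩ := hg r₁ l (by omega) (RamContext.mono hr₁ hl)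
  refine ⟨.seq p q, c + c', r₂, fun σ => (l₁ σ, l₂ σ), by omega,
    ⟨RamContext.mono hr₂ hl₁, hl₂⟩, fun σ => ?_⟩
  obtain ⟨σ₁, t₁, e₁, ht₁, k₁, v₁⟩ := H₁ σ
  obtain ⟨σ₂, t₂, e₂, ht₂, k₂, v₂⟩ := H₂ σ₁
  refine ⟨σ₂, _, .seq e₁ e₂, ?_, k₁.trans k₂ hr₁, ?_⟩
  · rw [k₁.2 1 (by omega)] at ht₂
    exact (Nat.add_le_add ht₁ ht₂).trans (polyTime_add_le ..)
  · simp only [v₂, RamContext.keeps (by omega) hl₁ k₂, v₁, RamContext.keeps hr hl k₁]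

/-- Functions that only re-read the registers. -/
theorem Easy.of_reads {g : Γ → Δ}
    (h : ∀ (r : ℕ) (l : RamState → Γ), RamContext.Reads r l → RamContext.Reads r fun σ => g (l σ)) :
    Easy g := fun r l _ hl =>
  ⟨.skip, 1, r, fun σ => g (l σ), le_rfl, h r l hl,
    fun σ => ⟨σ, 1, .skip σ, le_polyTime 1 _, .refl _ _, rfl⟩⟩

theorem Easy.id : Easy fun x : Γ => x := .of_reads fun _ _ h => h

theorem Easy.fst {f : Γ → Δ × Θ} (hf : Easy f) : Easy fun x => (f x).1 :=
  Easy.comp (Easy.of_reads (Γ := Δ × Θ) (g := Prod.fst) fun _ _ h => h.1) hf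

theorem Easy.snd {f : Γ → Δ × Θ} (hf : Easy f) : Easy fun x => (f x).2 :=
  Easy.comp (Easy.of_reads (Γ := Δ × Θ) (g := Prod.snd) fun _ _ h => h.2) hf

theorem Easy.level {f : Γ → RamInput} (hf : Easy f) : Easy fun x => (f x).level :=
  Easy.comp (g := RamInput.level) (fun r l hr hl =>
    ⟨.skip, 1, r, fun σ => σ.var 2, le_rfl, ⟨2, by omega, rfl⟩, fun σ =>
      ⟨σ, 1, .skip σ, le_polyTime 1 _, .refl _ _, by cases hl; rfl⟩⟩) hf

theorem Easy.len {f : Γ → RamInput} (hf : Easy f) : Easy fun x => (f x).len :=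
  Easy.comp (g := RamInput.len) (fun r l hr hl =>
    ⟨.skip, 1, r, fun σ => σ.var 0, le_rfl, ⟨0, by omega, rfl⟩, fun σ =>
      ⟨σ, 1, .skip σ, le_polyTime 1 _, .refl _ _, by cases hl; rfl⟩⟩) hf

theorem Easy.bound {f : Γ → RamInput} (hf : Easy f) : Easy fun x => (f x).bound :=
  Easy.comp (g := RamInput.bound) (fun r l hr hl =>
    ⟨.skip, 1, r, fun σ => σ.var 1, le_rfl, ⟨1, by omega, rfl⟩, fun σ =>
      ⟨σ, 1, .skip σ, le_polyTime 1 _, .refl _ _, by cases hl; rfl⟩⟩) hf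

/-- Functions given by one assignment. -/
theorem Easy.of_expr {g : Γ → ℕ}
    (h : ∀ (r : ℕ) (l : RamState → Γ), 3 ≤ r → RamContext.Reads r l →
      ∃ e : RamExpr, ∀ σ, e.eval σ = g (l σ)) : Easy g := by
  intro r l hr hl
  obtain ⟨e, he⟩ := h r l hr hl
  refine ⟨.assign r e, e.cost + 1, r + 1, fun σ => σ.var r, by omega, ⟨r, by omega, rfl⟩, fun σ =>
    ⟨_, _, .assign σ r e, le_polyTime .., RamState.keeps_setVar σ _ le_rfl, ?_⟩⟩
  simp [he]

theorem Easy.const (c : ℕ) : Easy fun _ : Γ => c :=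
  .of_expr fun _ _ _ _ => ⟨.const c, fun _ => rfl⟩

theorem Easy.add {f g : Γ → ℕ} (hf : Easy f) (hg : Easy g) : Easy fun x => f x + g x :=
  Easy.comp (g := fun p : ℕ × ℕ => p.1 + p.2) (.of_expr fun _ l _ hl => by
    obtain ⟨⟨i, -, hi⟩, ⟨j, -, hj⟩⟩ := hl
    exact ⟨.plus (.var i) (.var j), fun σ => by
      rw [congrFun hi σ, congrFun hj σ]; rfl⟩) (hf.prodMk hg)

theorem Easy.sub {f g : Γ → ℕ} (hf : Easy f) (hg : Easy g) : Easy fun x => f x - g x :=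
  Easy.comp (g := fun p : ℕ × ℕ => p.1 - p.2) (.of_expr fun _ l _ hl => by
    obtain ⟨⟨i, -, hi⟩, ⟨j, -, hj⟩⟩ := hl
    exact ⟨.minus (.var i) (.var j), fun σ => by
      rw [congrFun hi σ, congrFun hj σ]; rfl⟩) (hf.prodMk hg)

theorem Easy.get {f : Γ → RamInput} {g : Γ → ℕ} (hf : Easy f) (hg : Easy g) :
    Easy fun x => (f x).arr (g x) :=
  Easy.comp (g := fun p : RamInput × ℕ => p.1.arr p.2) (.of_expr fun _ l _ hl => by
    obtain ⟨hi, ⟨j, -, hj⟩⟩ := hl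
    exact ⟨.get 0 (.var j), fun σ => by
      rw [congrFun hi σ, congrFun hj σ]; rfl⟩) (hf.prodMk hg)

/-- Primitive recursion, where the number of iterations is the loop bound. -/
theorem Easy.natRec {h : Γ → RamInput} {f : Γ → ℕ} {g : Γ → ℕ → ℕ → ℕ} (hh : Easy h) (hf : Easy f)
    (hg : Easy fun p : Γ × ℕ × ℕ => g p.1 p.2.1 p.2.2) :
    Easy fun x => Nat.rec (motive := fun _ => ℕ) (f x) (g x) (h x).bound := by
  intro r l hr hl
  -- A `RamInput` can only be read off as `RamState.input`; so, whatever `h` is, the bound in its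
  -- value is variable `1`, which the program for `h` preserves.
  have hbound : ∀ σ, (h (l σ)).bound = σ.var 1 := by
    obtain ⟨p, c, r₁, l₁, hr₁, hl₁, H₁⟩ := hh r l hr hl
    intro σ
    obtain ⟨σ₁, t₁, -, -, k₁, v₁⟩ := H₁ σ
    cases hl₁
    rw [← v₁]
    exact k₁.2 1 (by omega)
  obtain ⟨p, c, a, l₁, ha, ⟨j, hj, rfl⟩, H₁⟩ := hf r l hr hl
  obtain ⟨q, c', r₂, l₂, hr₂, ⟨j', hj', rfl⟩, H₂⟩ := hg (a + 2)
    (fun σ => (l σ, σ.var (a + 1), σ.var a)) (by omega)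
    ⟨RamContext.mono (by omega) hl, ⟨a + 1, by omega, rfl⟩, ⟨a, by omega, rfl⟩⟩
  -- Register `a` is the accumulator and `a + 1` the counter; `q` leaves both untouched, and its
  -- result is copied to `a` before the counter moves.
  refine ⟨.seq p (.seq (.assign a (.var j)) (.seq (.assign (a + 1) (.const 0))
      (.loop (.minus (.var 1) (.var (a + 1)))
        (.seq q (.seq (.assign a (.var j'))
          (.assign (a + 1) (.plus (.var (a + 1)) (.const 1)))))))),
    c + 4 + (c' + 10 + 1) + 4, a + 1, fun σ => σ.var a, by omega, ⟨a, by omega, rfl⟩, fun σ => ?_⟩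
  obtain ⟨σ₁, t₁, e₁, ht₁, k₁, v₁⟩ := H₁ σ
  set M := σ.var 1 with hM
  let R : ℕ → ℕ := fun i => Nat.rec (motive := fun _ => ℕ) (f (l σ)) (g (l σ)) i
  obtain ⟨σ₃, t₃, e₃, ht₃, k₃, v₃, -⟩ := RamExec.exists_loop (p := .seq q (.seq (.assign a (.var j'))
          (.assign (a + 1) (.plus (.var (a + 1)) (.const 1)))))
      (e := .minus (.var 1) (.var (a + 1))) M (polyTime c' M + 6)
      (fun i τ => RamState.Keeps r σ τ ∧ τ.var a = R i ∧ τ.var (a + 1) = i) (by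
        rintro i hi τ ⟨k, va, vi⟩
        refine ⟨?_, ?_⟩
        · simp only [RamExpr.eval, vi, k.2 1 (by omega), ← hM]
          omega
        obtain ⟨τ', t, e, ht, k', v'⟩ := H₂ τ
        rw [k.2 1 (by omega), ← hM] at ht
        refine ⟨_, _, .seq e (.seq (.assign ..) (.assign ..)), ?_, ?_, ?_, ?_⟩
        · simp only [RamExpr.cost]
          omega
        · exact ((k.trans k' (by omega)).trans (RamState.keeps_setVar _ _ ha) le_rfl).trans
            (RamState.keeps_setVar _ _ (by omega)) le_rfl
        · rw [RamState.setVar_var_of_ne _ _ (by omega)]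
          simp only [RamState.setVar_var_self, RamExpr.eval]
          refine v'.trans ?_
          simp only [RamContext.keeps hr hl k, va, vi, R]
        · simp only [RamState.setVar_var_self, RamExpr.eval]
          rw [RamState.setVar_var_of_ne _ _ (by omega), k'.2 (a + 1) (by omega), vi])
      (by
        rintro τ ⟨k, -, vi⟩
        simp [RamExpr.eval, vi, k.2 1 (by omega), ← hM])
      (σ := (σ₁.setVar a (σ₁.var j)).setVar (a + 1) 0)
      ⟨(k₁.trans (RamState.keeps_setVar _ _ ha) le_rfl).trans
        (RamState.keeps_setVar _ _ (by omega)) le_rfl, by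
          rw [RamState.setVar_var_of_ne _ _ (by omega)]
          rw [RamState.setVar_var_self]
          exact v₁, by simp⟩
  refine ⟨σ₃, _, .seq e₁ (.seq (.assign ..) (.seq (.assign ..) e₃)), ?_, k₃, ?_⟩
  · simp only [RamExpr.cost] at ht₃ ⊢
    have h₁ : M * (polyTime c' M + 6 + (1 + 1 + 1) + 1) ≤ M * polyTime (c' + 10) M :=
      Nat.mul_le_mul_left _ (by
        have := polyTime_add_le c' 10 M
        have := le_polyTime 10 M
        omega)
    have h₂ := mul_polyTime_le (c' + 10) M
    have h₃ := polyTime_add_le c 4 M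
    have h₄ := polyTime_add_le (c + 4) (c' + 10 + 1) M
    have h₅ := polyTime_add_le (c + 4 + (c' + 10 + 1)) 4 M
    have h₆ := le_polyTime 4 M
    omega
  · simp only [hbound, v₃, R, ← hM]

theorem Easy.select {c f g : Γ → ℕ} (hc : Easy c) (hf : Easy f) (hg : Easy g) :
    Easy fun x => if c x = 0 then f x else g x := by
  refine Easy.comp (g := fun p : ℕ × ℕ × ℕ => if p.1 = 0 then p.2.1 else p.2.2) ?_
    (hc.prodMk (hf.prodMk hg))
  rintro r l hr ⟨⟨i, -, hi⟩, ⟨j, -, hj⟩, ⟨k, -, hk⟩⟩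
  refine ⟨.cond (.var i) (.assign r (.var k)) (.assign r (.var j)), 4, r + 1, fun σ => σ.var r,
    by omega, ⟨r, by omega, rfl⟩, fun σ => ?_⟩
  have hi := congrFun hi σ
  have hj := congrFun hj σ
  have hk := congrFun hk σ
  simp only at hi hj hk ⊢
  rw [hi, hj, hk]
  by_cases h : σ.var i = 0
  · exact ⟨_, _, .condFalse h (.assign ..), le_polyTime 4 _, RamState.keeps_setVar _ _ le_rfl,
      by simp [h, RamExpr.eval]⟩
  · exact ⟨_, _, .condTrue h (.assign ..), le_polyTime 4 _, RamState.keeps_setVar _ _ le_rfl,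
      by simp [h, RamExpr.eval]⟩

end Closure

/-- The indicator of a proposition. -/
noncomputable def indicator (p : Prop) : ℕ :=
  open Classical in if p then 1 else 0

theorem indicator_eq_ite (p : Prop) [Decidable p] : indicator p = if p then 1 else 0 := by
  unfold indicator
  congr

@[simp]
theorem indicator_eq_zero {p : Prop} : indicator p = 0 ↔ ¬ p := by
  by_cases h : p <;> simp [indicator, h]

/-- `p` is decided by a program in time polynomial in the loop bound. -/
def EasyPred {Γ : Type} [RamContext Γ] (p : Γ → Prop) : Prop :=
  Easy fun x => indicator (p x)

/-! ### Boolean combinations and bounded quantifiers -/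

section Predicates

variable {Γ : Type} [RamContext Γ]

theorem EasyPred.of_select {p : Γ → Prop} {c f g : Γ → ℕ} (hc : Easy c) (hf : Easy f)
    (hg : Easy g) (h : ∀ x, (if c x = 0 then f x else g x) = indicator (p x)) : EasyPred p := by
  have := Easy.select hc hf hg
  simp only [h] at this
  exact this

theorem EasyPred.lt {f g : Γ → ℕ} (hf : Easy f) (hg : Easy g) : EasyPred fun x => f x < g x :=
  .of_select (hg.sub hf) (.const 0) (.const 1) fun x => by
    by_cases h : f x < g x
    · simp [indicator, h, Nat.sub_eq_zero_iff_le]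
    · simp [indicator, h, not_lt.1 h]

theorem EasyPred.not {p : Γ → Prop} (hp : EasyPred p) : EasyPred fun x => ¬ p x :=
  .of_select hp (.const 1) (.const 0) fun x => by
    by_cases h : p x <;> simp [indicator, h]

theorem EasyPred.and {p q : Γ → Prop} (hp : EasyPred p) (hq : EasyPred q) :
    EasyPred fun x => p x ∧ q x :=
  .of_select hp (.const 0) hq fun x => by
    by_cases h : p x <;> by_cases h' : q x <;> simp [indicator, h, h']

theorem EasyPred.or {p q : Γ → Prop} (hp : EasyPred p) (hq : EasyPred q) :
    EasyPred fun x => p x ∨ q x :=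
  .of_select hp hq (.const 1) fun x => by
    by_cases h : p x <;> by_cases h' : q x <;> simp [indicator, h, h']

theorem EasyPred.imp {p q : Γ → Prop} (hp : EasyPred p) (hq : EasyPred q) :
    EasyPred fun x => p x → q x :=
  .of_select hp (.const 1) hq fun x => by
    by_cases h : p x <;> by_cases h' : q x <;> simp [indicator, h, h']

theorem EasyPred.le {f g : Γ → ℕ} (hf : Easy f) (hg : Easy g) : EasyPred fun x => f x ≤ g x := by
  simpa only [not_lt] using (EasyPred.lt hg hf).not

theorem EasyPred.eq {f g : Γ → ℕ} (hf : Easy f) (hg : Easy g) : EasyPred fun x => f x = g x := by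
  simpa only [← le_antisymm_iff] using (EasyPred.le hf hg).and (EasyPred.le hg hf)

theorem Easy.ite {p : Γ → Prop} {_ : DecidablePred p} {f g : Γ → ℕ} (hp : EasyPred p) (hf : Easy f)
    (hg : Easy g) : Easy fun x => if p x then f x else g x := by
  have := Easy.select hp hg hf
  simpa only [indicator_eq_zero, ite_not] using this

theorem Easy.sum {h : Γ → RamInput} {f : Γ → ℕ → ℕ} (hh : Easy h)
    (hf : Easy fun p : Γ × ℕ => f p.1 p.2) :
    Easy fun x => ∑ i ∈ Finset.range (h x).bound, f x i := by
  have := Easy.natRec (f := fun _ => 0) (g := fun x i a => a + f x i) hh (.const 0)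
    (Easy.add (Easy.snd (Easy.snd .id))
      (Easy.comp hf (Easy.prodMk (Easy.fst .id) (Easy.fst (Easy.snd .id)))))
  convert this using 2 with x
  induction (h x).bound with
  | zero => rfl
  | succ n ih => rw [Finset.sum_range_succ, ih]

/-- The sum of the indicators counts the witnesses; it vanishes exactly when there is none. -/
theorem EasyPred.bex {h : Γ → RamInput} {p : Γ → ℕ → Prop} (hh : Easy h)
    (hp : EasyPred fun y : Γ × ℕ => p y.1 y.2) :
    EasyPred fun x => ∃ i < (h x).bound, p x i :=
  .of_select (Easy.sum (f := fun x i => indicator (p x i)) hh hp) (.const 0) (.const 1) fun x => by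
    by_cases H : ∃ i < (h x).bound, p x i
    · rw [if_neg, indicator, if_pos H]
      simpa [indicator, Finset.sum_eq_zero_iff] using H
    · rw [if_pos, indicator, if_neg H]
      simpa [indicator, Finset.sum_eq_zero_iff] using H

theorem EasyPred.ball {h : Γ → RamInput} {p : Γ → ℕ → Prop} (hh : Easy h)
    (hp : EasyPred fun y : Γ × ℕ => p y.1 y.2) :
    EasyPred fun x => ∀ i < (h x).bound, p x i := by
  simpa using (EasyPred.bex (p := fun x i => ¬ p x i) hh hp.not).not

end Predicates

/-! ### Digits -/

namespace RamInput

/-- The base in which lists are encoded by numbers. -/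
def base (I : RamInput) : ℕ := I.len + 2

/-- The product of two numbers, the first of which is at most the loop bound. -/
def mul (I : RamInput) (x y : ℕ) : ℕ := ∑ i ∈ Finset.range I.bound, if i < x then y else 0

/-- The integer part of the quotient of a number below the loop bound and the base. -/
noncomputable def divBase (I : RamInput) (c : ℕ) : ℕ :=
  ∑ q ∈ Finset.range I.bound, indicator (I.mul I.base (q + 1) ≤ c)

/-- A number below the loop bound with its last `j` digits removed. -/
noncomputable def shift (I : RamInput) (c j : ℕ) : ℕ :=
  Nat.rec (motive := fun _ => ℕ) c (fun i a => if i < j then I.divBase a else a) I.bound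

/-- The digit number `j` of a number below the loop bound. -/
noncomputable def digit (I : RamInput) (c j : ℕ) : ℕ :=
  I.shift c j - I.mul I.base (I.divBase (I.shift c j))

/-- The number `c * base ^ j`. -/
def mulPow (I : RamInput) (c j : ℕ) : ℕ :=
  Nat.rec (motive := fun _ => ℕ) c (fun i a => if i < j then I.mul I.base a else a) I.bound

variable {I : RamInput}

theorem mul_eq {x y : ℕ} (h : x ≤ I.bound) : I.mul x y = x * y := by
  rw [mul, ← Finset.sum_filter, Finset.sum_const, smul_eq_mul]
  congr
  rw [show (Finset.range I.bound).filter (· < x) = Finset.range x by ext i; simp; omega]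
  simp

/-- The quotient is the number of positive multiples of the base up to `c`. -/
theorem divBase_eq (hb : I.base ≤ I.bound) {c : ℕ} (h : c < I.bound) :
    I.divBase c = c / I.base := by
  have hpos : 0 < I.base := by simp [base]
  simp only [divBase, mul_eq hb, indicator_eq_ite, ← Finset.sum_filter, Finset.sum_const,
    smul_eq_mul, mul_one]
  rw [show (Finset.range I.bound).filter (fun q => I.base * (q + 1) ≤ c) =
    Finset.range (c / I.base) by
      ext q
      have hle : c / I.base ≤ c := Nat.div_le_self _ _
      simp only [Finset.mem_filter, Finset.mem_range, mul_comm I.base, ← Nat.le_div_iff_mul_le hpos]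
      omega]
  simp

/-- Loops always run for the full bound; `j` iterations are obtained by idling afterwards. -/
theorem rec_ite_lt_eq_iterate (f : ℕ → ℕ) (c j n : ℕ) (h : j ≤ n) :
    Nat.rec (motive := fun _ => ℕ) c (fun i a => if i < j then f a else a) n = f^[j] c := by
  induction n with
  | zero => obtain rfl : j = 0 := by omega
            rfl
  | succ n ih =>
    rcases h.lt_or_eq with h | rfl
    · rw [← ih (by omega)]
      simp [show ¬ n < j by omega]
    · clear ih
      suffices H : ∀ k ≤ n + 1, Nat.rec (motive := fun _ => ℕ) c
          (fun i a => if i < n + 1 then f a else a) k = f^[k] c from H _ le_rfl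
      intro k hk
      induction k with
      | zero => rfl
      | succ k ih => simp only [show k < n + 1 by omega, if_true, ih (by omega),
          Function.iterate_succ_apply']

theorem shift_eq (hb : I.base ≤ I.bound) {c j : ℕ} (h : c < I.bound) (hj : j ≤ I.bound) :
    I.shift c j = c / I.base ^ j := by
  rw [shift, rec_ite_lt_eq_iterate _ _ _ _ hj]
  clear hj
  induction j with
  | zero => simp
  | succ j ih =>
    rw [Function.iterate_succ_apply', ih, divBase_eq hb ((Nat.div_le_self _ _).trans_lt h),
      Nat.div_div_eq_div_mul, pow_succ]

theorem digit_eq (hb : I.base ≤ I.bound) {c j : ℕ} (h : c < I.bound) (hj : j ≤ I.bound) :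
    I.digit c j = c / I.base ^ j % I.base := by
  rw [digit, shift_eq hb h hj, divBase_eq hb ((Nat.div_le_self _ _).trans_lt h), mul_eq hb]
  have := Nat.div_add_mod (c / I.base ^ j) I.base
  omega

theorem mulPow_eq (hb : I.base ≤ I.bound) {c j : ℕ} (hj : j ≤ I.bound) :
    I.mulPow c j = c * I.base ^ j := by
  rw [mulPow, rec_ite_lt_eq_iterate _ _ _ _ hj]
  clear hj
  induction j with
  | zero => simp
  | succ j ih => rw [Function.iterate_succ_apply', ih, mul_eq hb, pow_succ]; ring

/-- Every list of numbers below the base is the list of digits of a number. -/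
theorem exists_digit_eq (hb : I.base ≤ I.bound) (l : List ℕ) (hl : ∀ x ∈ l, x < I.base)
    (h : I.base ^ l.length ≤ I.bound) :
    ∃ c < I.bound, ∀ j ≤ I.bound, I.digit c j = l.getD j 0 := by
  have hb1 : 1 < I.base := by simp [base]
  have hlt : Nat.ofDigits I.base l < I.bound := (Nat.ofDigits_lt_base_pow_length hb1 hl).trans_le h
  refine ⟨_, hlt, fun j hj => ?_⟩
  rw [digit_eq hb hlt hj]
  clear hlt hj h
  induction l generalizing j with
  | nil => simp
  | cons x l ih =>
    have hx := hl x (by simp)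
    rw [Nat.ofDigits_cons]
    cases j with
    | zero => simp [Nat.mod_eq_of_lt hx]
    | succ j =>
      rw [pow_succ', ← Nat.div_div_eq_div_mul, Nat.add_mul_div_left _ _ (by omega),
        Nat.div_eq_of_lt hx, zero_add, ih (fun y hy => hl y (by simp [hy]))]
      simp

end RamInput

/-! ### Digit operations are easy -/

section DigitClosure

variable {Γ : Type} [RamContext Γ] {h : Γ → RamInput}

theorem Easy.base (hh : Easy h) : Easy fun x => (h x).base :=
  hh.len.add (.const 2)

theorem Easy.mul {f g : Γ → ℕ} (hh : Easy h) (hf : Easy f) (hg : Easy g) :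
    Easy fun x => (h x).mul (f x) (g x) :=
  Easy.sum (f := fun x i => if i < f x then g x else 0) hh
    (.ite (.lt (Easy.snd .id) (hf.comp (Easy.fst .id))) (hg.comp (Easy.fst .id)) (.const 0))

theorem Easy.divBase {f : Γ → ℕ} (hh : Easy h) (hf : Easy f) :
    Easy fun x => (h x).divBase (f x) :=
  Easy.sum hh (EasyPred.le (.mul (hh.comp (Easy.fst .id)) (Easy.base (hh.comp (Easy.fst .id)))
    ((Easy.snd .id).add (.const 1))) (hf.comp (Easy.fst .id)))

theorem Easy.shift {f g : Γ → ℕ} (hh : Easy h) (hf : Easy f) (hg : Easy g) :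
    Easy fun x => (h x).shift (f x) (g x) :=
  Easy.natRec (g := fun x i a => if i < g x then (h x).divBase a else a) hh hf
    (.ite (.lt (Easy.fst (Easy.snd .id)) (hg.comp (Easy.fst .id)))
      (.divBase (hh.comp (Easy.fst .id)) (Easy.snd (Easy.snd .id))) (Easy.snd (Easy.snd .id)))

theorem Easy.digit {f g : Γ → ℕ} (hh : Easy h) (hf : Easy f) (hg : Easy g) :
    Easy fun x => (h x).digit (f x) (g x) :=
  (hh.shift hf hg).sub (hh.mul hh.base (hh.divBase (hh.shift hf hg)))

theorem Easy.mulPow {f g : Γ → ℕ} (hh : Easy h) (hf : Easy f) (hg : Easy g) :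
    Easy fun x => (h x).mulPow (f x) (g x) :=
  Easy.natRec (g := fun x i a => if i < g x then (h x).mul (h x).base a else a) hh hf
    (.ite (.lt (Easy.fst (Easy.snd .id)) (hg.comp (Easy.fst .id)))
      (.mul (hh.comp (Easy.fst .id)) (Easy.base (hh.comp (Easy.fst .id)))
        (Easy.snd (Easy.snd .id))) (Easy.snd (Easy.snd .id)))

end DigitClosure

/-! ### Journeys -/

section Journeys

variable {V : Type}

/-- `Journey E x τ y s n`: starting at `x` not before time `τ`, one can be at `y` and ready for
labels `≥ s` after `n` time edges of `E` with increasing labels. -/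
inductive Journey (E : Finset (Sym2 V × ℕ)) (x : V) (τ : ℕ) : V → ℕ → ℕ → Prop
  | refl : Journey E x τ x τ 0
  | step {u v : V} {s l n : ℕ} : Journey E x τ u s n → (s(u, v), l) ∈ E → s ≤ l →
      Journey E x τ v (l + 1) (n + 1)

/-- The labels of the edges at a vertex are distinct. -/
def ProperEdges (E : Finset (Sym2 V × ℕ)) : Prop :=
  ∀ a b c l, (s(a, b), l) ∈ E → (s(a, c), l) ∈ E → b = c

/-- Every vertex reaches every vertex. -/
def Connects (E : Finset (Sym2 V × ℕ)) : Prop :=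
  ∀ u v, ∃ s n, Journey E u 0 v s n

variable {E E' : Finset (Sym2 V × ℕ)} {x y : V} {τ s n : ℕ}

theorem Journey.mono (h : Journey E x τ y s n) (hE : E ⊆ E') : Journey E' x τ y s n := by
  induction h with
  | refl => exact .refl
  | step _ he hs ih => exact ih.step (hE he) hs

theorem Journey.le (h : Journey E x τ y s n) : τ ≤ s := by
  induction h with
  | refl => exact le_rfl
  | step _ _ hs ih => omega

theorem Journey.exists_last (h : Journey E x τ y s n) (hxy : y ≠ x) :
    ∃ u s' l n', Journey E x τ u s' n' ∧ (s(u, y), l) ∈ E ∧ s' ≤ l ∧ s = l + 1 := by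
  cases h with
  | refl => exact absurd rfl hxy
  | step h he hs => exact ⟨_, _, _, _, h, he, hs, rfl⟩

theorem Journey.cons {z : V} {l : ℕ} (he : (s(z, x), l) ∈ E) {τ' : ℕ} (hl : τ' ≤ l)
    (h : Journey E x (l + 1) y s n) : Journey E z τ' y s (n + 1) := by
  induction h with
  | refl => exact .step .refl he hl
  | step _ he' hs ih => exact ih.step he' hs

theorem ProperEdges.mono (h : ProperEdges E') (hE : E ⊆ E') : ProperEdges E :=
  fun a b c l hb hc => h a b c l (hE hb) (hE hc)

namespace TemporalGraph

variable {H : TemporalGraph V}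

theorem IsHappy.properEdges (h : H.IsHappy) : ProperEdges H.timeEdges := by
  intro a b c l hb hc
  by_contra hbc
  exact h.2 _ _ _ _ hb hc (fun h => hbc (Sym2.congr_right.1 h))
    ⟨a, Sym2.mem_mk_left _ _, Sym2.mem_mk_left _ _⟩ rfl

/-- Consecutive edges of a path are distinct and share a vertex, so properness turns `≤` between
their labels into `<`. The lower bound `τ` on the first label lets the induction continue from time
`t + 1`. -/
theorem exists_journey_of_walk {κ : PathKind} (hH : ProperEdges H.timeEdges) {u v : V}
    (p : H.underlying.Walk u v) (hp : p.IsPath) (ts : List ℕ)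
    (hts : List.Forall₂ (fun e t => (e, t) ∈ H.timeEdges) p.edges ts) (hrel : ts.Pairwise κ.Rel)
    (τ : ℕ) (hτ : ∀ t ∈ ts.head?, τ ≤ t) : ∃ s n, Journey H.timeEdges u τ v s n := by
  induction p generalizing ts τ with
  | nil => exact ⟨_, _, .refl⟩
  | @cons u z v h p ih =>
    rw [SimpleGraph.Walk.edges_cons] at hts
    cases hts with
    | @cons _ t _ ts' he hts =>
      have hp' := (SimpleGraph.Walk.cons_isPath_iff _ _).1 hp
      obtain ⟨s, n, J⟩ := ih hp'.1 ts' hts hrel.of_cons (t + 1) (by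
        intro t' ht'
        cases p with
        | nil =>
          rw [SimpleGraph.Walk.edges_nil] at hts
          cases hts
          simp at ht'
        | @cons _ z' _ h' p =>
          rw [SimpleGraph.Walk.edges_cons] at hts
          cases hts with
          | @cons _ t₂ _ ts₂ he' hts =>
            simp only [List.head?_cons, Option.mem_some_iff] at ht'
            subst ht'
            have hr : κ.Rel t t₂ := List.rel_of_pairwise_cons hrel (by simp)
            have hle : t ≤ t₂ := by
              cases κ
              · exact le_of_lt hr
              · exact hr
            have hne : t ≠ t₂ := by
              rintro rfl
              rw [Sym2.eq_swap] at he
              have := hH _ _ _ _ he he'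
              subst this
              exact hp'.2 (by simp)
            omega)
      exact ⟨s, n + 1, J.cons he (hτ t (by simp))⟩

/-- A journey may revisit vertices. If the next vertex already lies on the path found so far, that
path and its label list are cut there. -/
theorem Reaches.of_journey [DecidableEq V] {κ : PathKind} {u v : V} {s n : ℕ}
    (J : Journey H.timeEdges u 0 v s n) : H.Reaches κ u v := by
  suffices h : ∃ p : H.underlying.Walk u v, p.IsPath ∧ ∃ ts : List ℕ,
      List.Forall₂ (fun e t => (e, t) ∈ H.timeEdges) p.edges ts ∧ ts.Pairwise (· < ·) ∧
        ∀ t ∈ ts, t < s by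
    obtain ⟨p, hp, ts, h₁, h₂, -⟩ := h
    refine ⟨p, hp, ts, h₁, h₂.imp fun {a b} hab => ?_⟩
    cases κ
    · exact hab
    · exact le_of_lt hab
  induction J with
  | refl => exact ⟨.nil, .nil, [], by simp, .nil, by simp⟩
  | @step a v s l n _ he hs ih =>
    obtain ⟨p, hp, ts, h₁, h₂, h₃⟩ := ih
    by_cases hv : v ∈ p.support
    · have hsplit := congrArg SimpleGraph.Walk.edges (p.take_spec hv)
      rw [SimpleGraph.Walk.edges_append] at hsplit
      have h₄ := List.forall₂_take (p.takeUntil v hv).edges.length h₁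
      rw [← hsplit, List.take_left] at h₄
      exact ⟨p.takeUntil v hv, hp.takeUntil hv, _, h₄, h₂.sublist (List.take_sublist _ _),
        fun t ht => by have := h₃ t (List.mem_of_mem_take ht); omega⟩
    · have hadj : H.underlying.Adj a v := ⟨l, he⟩
      refine ⟨p.concat hadj, hp.concat hv _, ts ++ [l], ?_, ?_, ?_⟩
      · rw [SimpleGraph.Walk.edges_concat, List.concat_eq_append]
        exact List.rel_append h₁ (by simpa using he)
      · rw [List.pairwise_append]
        exact ⟨h₂, by simp, fun t ht t' ht' => by
          obtain rfl : t' = l := by simpa using ht'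
          have := h₃ t ht
          omega⟩
      · intro t ht
        rcases List.mem_append.1 ht with ht | ht
        · have := h₃ t ht
          omega
        · obtain rfl : t = l := by simpa using ht
          omega

theorem isTC_iff_connects [DecidableEq V] {κ : PathKind} (hH : ProperEdges H.timeEdges) :
    H.IsTC κ ↔ Connects H.timeEdges := by
  refine ⟨fun h u v => ?_, fun h u v => ?_⟩
  · obtain ⟨p, hp, ts, h₁, h₂⟩ := h u v
    exact exists_journey_of_walk hH p hp ts h₁ h₂ 0 (by simp)
  · obtain ⟨s, n, J⟩ := h u v
    exact .of_journey J

end TemporalGraph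

theorem HappyInstance.hasSmallSpanner_iff {κ : PathKind} (I : HappyInstance κ) :
    I.HasSmallSpanner ↔ ∃ E ⊆ I.graph.timeEdges, Connects E ∧ E.card ≤ I.k := by
  have hG := I.happy.properEdges
  constructor
  · rintro ⟨H, ⟨hE, -, hTC⟩, hk⟩
    exact ⟨_, hE, (TemporalGraph.isTC_iff_connects (hG.mono hE)).1 hTC, hk⟩
  · rintro ⟨E, hE, hc, hk⟩
    exact ⟨⟨E, I.graph.maxLabel, fun e t h => I.graph.not_isDiag e t (hE h),
      fun e t h => I.graph.one_le_label e t (hE h), fun e t h => I.graph.label_le e t (hE h)⟩,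
      ⟨hE, le_rfl, (TemporalGraph.isTC_iff_connects (hG.mono hE)).2 hc⟩, hk⟩

end Journeys

/-! ### Certificates for small spanners -/

section Certificates

variable {V : Type}

/-- The time edge `e` leads from `v` to `x` not after time `τ`, for some `(x, τ)` in `P`. -/
def OutEdge (P : Set (V × ℕ)) (v : V) (e : Sym2 V × ℕ) : Prop :=
  ∃ x τ, (x, τ) ∈ P ∧ e.1 = s(v, x) ∧ e.2 ≤ τ

/-- The time edge `e` leads from `y` to `v` not before time `θ`, for some `(y, θ)` in `Q`. -/
def InEdge (Q : Set (V × ℕ)) (v : V) (e : Sym2 V × ℕ) : Prop :=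
  ∃ y θ, (y, θ) ∈ Q ∧ e.1 = s(v, y) ∧ θ ≤ e.2

/-- The vertex `v` gets to a vertex of `P` in time, along at most one time edge of `S`. -/
def OutGood (P : Set (V × ℕ)) (S : Finset (Sym2 V × ℕ)) (v : V) : Prop :=
  (∃ τ, (v, τ) ∈ P) ∨ ∃ e ∈ S, OutEdge P v e

/-- The vertex `v` is reached in time from a vertex of `Q`, along at most one time edge of `S`. -/
def InGood (Q : Set (V × ℕ)) (S : Finset (Sym2 V × ℕ)) (v : V) : Prop :=
  (∃ θ, (v, θ) ∈ Q) ∨ ∃ e ∈ S, InEdge Q v e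

/-- The number of time edges of `G` at `v` that `F` lacks. -/
noncomputable def missing (G F : Finset (Sym2 V × ℕ)) (P Q : Set (V × ℕ)) (v : V) : ℕ :=
  open Classical in
  if OutGood P F v ∧ InGood Q F v then 0
  else if OutGood P F v ∨ InGood Q F v ∨ ∃ e ∈ G, OutEdge P v e ∧ InEdge Q v e then 1
  else 2

/-- `F` links all vertices of `P` to all vertices of `Q` in time, and every vertex can be attached
to both by edges of `G`. -/
structure SpannerCore (G F : Finset (Sym2 V × ℕ)) (P Q : Set (V × ℕ)) : Prop where
  subset : F ⊆ G
  link : ∀ x τ y θ, (x, τ) ∈ P → (y, θ) ∈ Q → τ ≤ θ ∧ ∃ s n, Journey F x τ y s n ∧ s ≤ θ + 1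
  outGood : ∀ v, OutGood P G v
  inGood : ∀ v, InGood Q G v

variable {E F G : Finset (Sym2 V × ℕ)} {P Q : Set (V × ℕ)} {x : V}

/-- If `t` equals the first label of the journey, the two edges share `x` and hence coincide, and
the detour `u, x, u` is dropped. The empty journey is kept apart because prepending an edge to it
may raise the ready time above `s`. -/
theorem Journey.prepend (hE : ProperEdges E) {u x y : V} {t τ s n : ℕ} (he : (s(u, x), t) ∈ E)
    (ht : t ≤ τ) (h : Journey E x τ y s n) :
    (∃ s' n', s' ≤ s ∧ Journey E u 0 y s' n') ∨ y = x ∧ s = τ := by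
  induction h with
  | refl => exact .inr ⟨rfl, rfl⟩
  | @step a z s l n _ he' hs ih =>
    left
    rcases ih with ⟨s', n', hs', J⟩ | ⟨rfl, rfl⟩
    · exact ⟨_, _, le_rfl, J.step he' (hs'.trans hs)⟩
    · rcases (ht.trans hs).eq_or_lt with rfl | hlt
      · rw [Sym2.eq_swap] at he
        obtain rfl := hE _ _ _ _ he he'
        exact ⟨0, 0, by omega, .refl⟩
      · exact ⟨_, _, le_rfl, (Journey.refl.step he (Nat.zero_le t)).step he' hlt⟩

/-- Departure edge, link and arrival edge are concatenated. Equal labels at a junction are harmless: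
they belong to the same edge, so at the end the journey has already been at `v`. -/
theorem Journey.of_link (hE : ProperEdges E) {u v x y : V} {τ θ s n : ℕ}
    (hu : u = x ∨ ∃ t, (s(u, x), t) ∈ E ∧ t ≤ τ) (hv : v = y ∨ ∃ t, (s(v, y), t) ∈ E ∧ θ ≤ t)
    (hτ : τ ≤ θ) (h : Journey E x τ y s n) (hs : s ≤ θ + 1) :
    ∃ s n, Journey E u 0 v s n := by
  have h₁ : ∃ s' n', s' ≤ θ + 1 ∧ Journey E u 0 y s' n' := by
    rcases hu with rfl | ⟨t, he, ht⟩
    · have : ∃ s' n', s' ≤ s ∧ Journey E u 0 y s' n' := by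
        clear hs hv hτ
        induction h with
        | refl => exact ⟨0, 0, Nat.zero_le _, .refl⟩
        | step _ he hs ih =>
          obtain ⟨s', n', hs', J⟩ := ih
          exact ⟨_, _, le_rfl, J.step he (hs'.trans hs)⟩
      obtain ⟨s', n', hs', J⟩ := this
      exact ⟨s', n', hs'.trans hs, J⟩
    · rcases h.prepend hE he ht with ⟨s', n', hs', J⟩ | ⟨rfl, rfl⟩
      · exact ⟨s', n', hs'.trans hs, J⟩
      · exact ⟨t + 1, _, by omega, Journey.refl.step he (Nat.zero_le t)⟩
  obtain ⟨s', n', hs', J⟩ := h₁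
  rcases hv with rfl | ⟨t, he, ht⟩
  · exact ⟨_, _, J⟩
  · rw [Sym2.eq_swap] at he
    by_cases hlt : s' ≤ t
    · exact ⟨_, _, J.step he hlt⟩
    · cases J with
      | refl => omega
      | @step z _ s₀ l _ J he' hs₀ =>
        obtain rfl : l = t := by omega
        rw [Sym2.eq_swap] at he'
        obtain rfl := hE _ _ _ _ he he'
        exact ⟨_, _, J⟩

theorem OutGood.exists (h : OutGood P E x) : ∃ y τ, (y, τ) ∈ P ∧
    (x = y ∨ ∃ t, (s(x, y), t) ∈ E ∧ t ≤ τ) := by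
  rcases h with ⟨τ, h⟩ | ⟨⟨e, t⟩, he, y, τ, h, rfl, ht⟩
  · exact ⟨x, τ, h, .inl rfl⟩
  · exact ⟨y, τ, h, .inr ⟨t, he, ht⟩⟩

theorem InGood.exists (h : InGood Q E x) : ∃ y θ, (y, θ) ∈ Q ∧
    (x = y ∨ ∃ t, (s(x, y), t) ∈ E ∧ θ ≤ t) := by
  rcases h with ⟨τ, h⟩ | ⟨⟨e, t⟩, he, y, τ, h, rfl, ht⟩
  · exact ⟨x, τ, h, .inl rfl⟩
  · exact ⟨y, τ, h, .inr ⟨t, he, ht⟩⟩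

theorem OutGood.mono (h : OutGood P E x) (hE : E ⊆ F) : OutGood P F x :=
  h.imp_right fun ⟨e, he, h⟩ => ⟨e, hE he, h⟩

theorem InGood.mono (h : InGood Q E x) (hE : E ⊆ F) : InGood Q F x :=
  h.imp_right fun ⟨e, he, h⟩ => ⟨e, hE he, h⟩

/-- A core can be completed to a spanner by the missing edges. -/
theorem SpannerCore.exists_connects [Fintype V] [DecidableEq V] (hG : ProperEdges G)
    (h : SpannerCore G F P Q) :
    ∃ H ⊆ G, Connects H ∧ H.card ≤ F.card + ∑ v, missing G F P Q v := by
  have hA : ∀ v, ∃ A ⊆ G, A.card ≤ missing G F P Q v ∧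
      OutGood P (F ∪ A) v ∧ InGood Q (F ∪ A) v := by
    intro v
    have hsub : ∀ A : Finset (Sym2 V × ℕ), F ⊆ F ∪ A := fun A => Finset.subset_union_left
    by_cases h₀ : OutGood P F v ∧ InGood Q F v
    · exact ⟨∅, by simp, by simp, by simpa using h₀⟩
    by_cases ho : OutGood P F v
    · have hi := (not_and.1 h₀) ho
      rcases h.inGood v with ⟨θ, hθ⟩ | ⟨e, he, hv⟩
      · exact absurd (.inl ⟨θ, hθ⟩) hi
      · exact ⟨{e}, by simpa using he, by simp [missing, ho, hi], ho.mono (hsub _),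
          .inr ⟨e, by simp, hv⟩⟩
    rcases h.outGood v with ⟨τ, hτ⟩ | ⟨e, he, hv⟩
    · exact absurd (.inl ⟨τ, hτ⟩) ho
    by_cases hi : InGood Q F v
    · exact ⟨{e}, by simpa using he, by simp [missing, ho, hi], .inr ⟨e, by simp, hv⟩,
        hi.mono (hsub _)⟩
    -- A single edge may serve both for departing and for arriving.
    by_cases hb : ∃ e ∈ G, OutEdge P v e ∧ InEdge Q v e
    · obtain ⟨e, he, h₁, h₂⟩ := hb
      have hb : ∃ e ∈ G, OutEdge P v e ∧ InEdge Q v e := ⟨e, he, h₁, h₂⟩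
      refine ⟨{e}, by simpa using he, ?_, .inr ⟨e, by simp, h₁⟩, .inr ⟨e, by simp, h₂⟩⟩
      rw [missing, if_neg h₀, if_pos (.inr (.inr hb))]
      simp
    · rcases h.inGood v with ⟨θ, hθ⟩ | ⟨e', he', hv'⟩
      · exact absurd (.inl ⟨θ, hθ⟩) hi
      refine ⟨{e, e'}, ?_, ?_, .inr ⟨e, by simp, hv⟩, .inr ⟨e', by simp, hv'⟩⟩
      · intro a ha
        rcases Finset.mem_insert.1 ha with rfl | ha
        · exact he
        · rwa [Finset.mem_singleton.1 ha]
      · rw [missing, if_neg h₀, if_neg fun h => h.elim ho fun h => h.elim hi hb]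
        exact Finset.card_le_two
  choose A hAG hAcard hAo hAi using hA
  have hHG : F ∪ Finset.univ.biUnion A ⊆ G :=
    Finset.union_subset h.subset (Finset.biUnion_subset.2 fun v _ => hAG v)
  have hsub : ∀ v, F ∪ A v ⊆ F ∪ Finset.univ.biUnion A := fun v =>
    Finset.union_subset_union_right (Finset.subset_biUnion_of_mem A (Finset.mem_univ v))
  refine ⟨F ∪ Finset.univ.biUnion A, hHG, fun u v => ?_, ?_⟩
  · obtain ⟨x, τ, hP, hu⟩ := ((hAo u).mono (hsub u)).exists
    obtain ⟨y, θ, hQ, hv⟩ := ((hAi v).mono (hsub v)).exists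
    obtain ⟨hτ, s, n, J, hs⟩ := h.link x τ y θ hP hQ
    exact Journey.of_link (hG.mono hHG) hu hv hτ (J.mono Finset.subset_union_left) hs
  · calc (F ∪ Finset.univ.biUnion A).card ≤ F.card + (Finset.univ.biUnion A).card :=
          Finset.card_union_le _ _
      _ ≤ F.card + ∑ v, (A v).card := Nat.add_le_add_left Finset.card_biUnion_le _
      _ ≤ _ := Nat.add_le_add_left (Finset.sum_le_sum fun v _ => hAcard v) _

/-- Foremost journeys to the vertices of a vertex cover need few edges. -/
theorem exists_foremost_tree [DecidableEq V] {X : Finset V}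
    (hX : ∀ a b l, (s(a, b), l) ∈ E → a ∈ X ∨ b ∈ X) {x : V} {τ : ℕ}
    (hx : ∀ y, ∃ s n, Journey E x τ y s n) :
    ∃ F ⊆ E, F.card ≤ 2 * X.card ∧ ∀ y ∈ X, ∀ s n, Journey E x τ y s n →
      ∃ s' n', s' ≤ s ∧ n' ≤ 2 * X.card ∧ Journey F x τ y s' n' := by
  classical
  let a : V → ℕ := fun y => Nat.find (hx y)
  have ha : ∀ y, ∃ n, Journey E x τ y (a y) n := fun y => Nat.find_spec (hx y)
  have hle : ∀ {y s n}, Journey E x τ y s n → a y ≤ s := fun J => Nat.find_min' _ ⟨_, J⟩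
  have hpred : ∀ y, ∃ u l, y ≠ x → (s(u, y), l) ∈ E ∧ a u ≤ l ∧ a y = l + 1 := by
    intro y
    by_cases hy : y = x
    · exact ⟨y, 0, fun h => absurd hy h⟩
    · obtain ⟨n, J⟩ := ha y
      obtain ⟨u, s', l, n', J', he, hs', hl⟩ := J.exists_last hy
      exact ⟨u, l, fun _ => ⟨he, (hle J').trans hs', hl⟩⟩
  choose u l hul using hpred
  have hax : a x = τ := le_antisymm (hle .refl) (by obtain ⟨n, J⟩ := ha x; exact J.le)
  let e : V → Sym2 V × ℕ := fun y => (s(u y, y), l y)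
  -- For each cover vertex, its predecessor edge and the predecessor edge of its predecessor.
  -- Intersecting with `E` removes the dummy edge of `x`, which has no predecessor.
  let F := (X.image e ∪ X.image (fun y => e (u y))) ∩ E
  have hF : ∀ y ∈ X, y ≠ x → e y ∈ F := fun y hy hyx => Finset.mem_inter.2
    ⟨Finset.mem_union_left _ (Finset.mem_image_of_mem _ hy), (hul y hyx).1⟩
  have hF' : ∀ y ∈ X, u y ≠ x → e (u y) ∈ F := fun y hy hyx => Finset.mem_inter.2
    ⟨Finset.mem_union_right _ (Finset.mem_image_of_mem (fun y => e (u y)) hy), (hul _ hyx).1⟩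
  -- Induction on the arrival time: each return to the cover costs at most two edges and uses up a
  -- cover vertex with a new, larger arrival time.
  have hJ : ∀ k, ∀ y ∈ X, a y = k →
      ∃ n, n ≤ 2 * (X.filter fun z => a z ≤ k).card ∧ Journey F x τ y k n := by
    intro k
    induction k using Nat.strong_induction_on with
    | _ k ih =>
      intro y hy hyk
      by_cases hyx : y = x
      · subst hyx
        rw [← hyk, hax]
        exact ⟨0, Nat.zero_le _, .refl⟩
      obtain ⟨he, hu, hay⟩ := hul y hyx
      have hcard : ∀ k' < k, (X.filter fun z => a z ≤ k').card + 1 ≤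
          (X.filter fun z => a z ≤ k).card := by
        intro k' hk'
        refine Finset.card_lt_card ⟨fun z hz => ?_, fun hs => ?_⟩
        · have := Finset.mem_filter.1 hz
          exact Finset.mem_filter.2 ⟨this.1, by omega⟩
        · have := Finset.mem_filter.1 (hs (Finset.mem_filter.2 ⟨hy, hyk.le⟩))
          omega
      by_cases hux : u y = x
      · refine ⟨1, ?_, ?_⟩
        · have : 0 < (X.filter fun z => a z ≤ k).card :=
            Finset.card_pos.2 ⟨y, Finset.mem_filter.2 ⟨hy, hyk.le⟩⟩
          omega
        · have hey := hF y hy hyx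
          rw [← hyk, hay]
          refine Journey.step (u := u y) (s := τ) ?_ hey (by rw [← hax, ← hux]; exact hu)
          rw [hux]
          exact .refl
      -- If the predecessor is outside the cover, then its own predecessor is inside.
      by_cases huX : u y ∈ X
      · obtain ⟨n, hn, J⟩ := ih (a (u y)) (by omega) (u y) huX rfl
        have := hcard (a (u y)) (by omega)
        refine ⟨n + 1, by omega, ?_⟩
        rw [← hyk, hay]
        exact J.step (hF y hy hyx) hu
      · obtain ⟨he', hu', hay'⟩ := hul (u y) hux
        have hu'X : u (u y) ∈ X := (hX _ _ _ he').resolve_right huX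
        obtain ⟨n, hn, J⟩ := ih (a (u (u y))) (by omega) _ hu'X rfl
        have := hcard (a (u (u y))) (by omega)
        refine ⟨n + 1 + 1, by omega, ?_⟩
        rw [← hyk, hay]
        exact (J.step (hF' y hy hux) hu').step (hF y hy hyx) (by omega)
  refine ⟨F, Finset.inter_subset_right, ?_, fun y hy s n J => ?_⟩
  · calc F.card ≤ (X.image e ∪ X.image (fun y => e (u y))).card :=
          Finset.card_le_card Finset.inter_subset_left
      _ ≤ _ := Finset.card_union_le _ _
      _ ≤ X.card + X.card := Nat.add_le_add Finset.card_image_le Finset.card_image_le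
      _ = _ := by ring
  · obtain ⟨n', hn', J'⟩ := hJ _ y hy rfl
    exact ⟨_, n', hle J, hn'.trans (Nat.mul_le_mul_left _
      (Finset.card_le_card (Finset.filter_subset _ _))), J'⟩

end Certificates

/-! ### Extracting a small core from a connecting set -/

section Completeness

variable {V : Type} {E F G : Finset (Sym2 V × ℕ)}

theorem Connects.exists_edge [Nontrivial V] (hE : Connects E) (v : V) : ∃ z t, (s(v, z), t) ∈ E
    := by
  obtain ⟨z, hz⟩ := exists_ne v
  obtain ⟨s, n, J⟩ := hE z v
  obtain ⟨u, _, l, _, _, he, -⟩ := J.exists_last hz.symm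
  exact ⟨u, l, by rwa [Sym2.eq_swap]⟩

theorem Connects.exists_first [Nontrivial V] (hE : Connects E) (v : V) :
    ∃ z t, (s(v, z), t) ∈ E ∧ ∀ z' t', (s(v, z'), t') ∈ E → t ≤ t' := by
  classical
  have h : ∃ t z, (s(v, z), t) ∈ E := by
    obtain ⟨z, t, h⟩ := hE.exists_edge v
    exact ⟨t, z, h⟩
  obtain ⟨z, hz⟩ := Nat.find_spec h
  exact ⟨z, _, hz, fun z' t' h' => Nat.find_min' h ⟨z', h'⟩⟩

theorem Connects.exists_last [Nontrivial V] (hE : Connects E) (v : V) :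
    ∃ z t, (s(v, z), t) ∈ E ∧ ∀ z' t', (s(v, z'), t') ∈ E → t' ≤ t := by
  classical
  obtain ⟨z, t, h⟩ := hE.exists_edge v
  obtain ⟨⟨e, t⟩, he, hmax⟩ := (E.filter fun e => v ∈ e.1).exists_max_image (fun e => e.2)
    ⟨(s(v, z), t), by simp [h]⟩
  obtain ⟨he, z, rfl⟩ := Finset.mem_filter.1 he
  exact ⟨z, t, he, fun z' t' hz => hmax (s(v, z'), t') (by simp [hz])⟩

/-- If the first edge at `v` leads to `x` at time `τ`, then everything that can be reached from `v`
can be reached from `x` from time `τ` on. -/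
theorem Journey.of_first (hE : ProperEdges E) {v x y : V} {τ s n : ℕ} (he : (s(v, x), τ) ∈ E)
    (hτ : ∀ z t, (s(v, z), t) ∈ E → τ ≤ t) (h : Journey E v 0 y s n) :
    y = v ∨ ∃ s' n', s' ≤ s ∧ Journey E x τ y s' n' := by
  -- The journey from `x` goes back to `v` along the first edge; any other edge at `v` has a label
  -- above `τ` and can follow.
  have hv : Journey E x τ v (τ + 1) 1 := Journey.refl.step (by rwa [Sym2.eq_swap]) le_rfl
  induction h with
  | refl => exact .inl rfl
  | @step u z s l n _ he' hs ih =>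
    right
    rcases ih with rfl | ⟨s', n', hs', J⟩
    · rcases (hτ _ _ he').eq_or_lt with rfl | hlt
      · obtain rfl := hE _ _ _ _ he he'
        exact ⟨_, _, Nat.le_succ _, .refl⟩
      · exact ⟨_, _, le_rfl, hv.step he' hlt⟩
    · exact ⟨_, _, le_rfl, J.step he' (hs'.trans hs)⟩

/-- If the last edge at `w` leads to `y` at time `θ`, then whoever reaches `w` reaches `y` before
it. -/
theorem Journey.of_last (hE : ProperEdges E) {w x y : V} {τ θ s n : ℕ} (he : (s(w, y), θ) ∈ E)
    (hθ : ∀ z t, (s(w, z), t) ∈ E → t ≤ θ) (h : Journey E x τ w s n) (hxw : w ≠ x) :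
    τ ≤ θ ∧ ∃ s' n', Journey E x τ y s' n' ∧ s' ≤ θ + 1 := by
  obtain ⟨u, s', l, n', J, he', hs', rfl⟩ := h.exists_last hxw
  rw [Sym2.eq_swap] at he'
  have hle := hθ _ _ he'
  refine ⟨J.le.trans (hs'.trans hle), ?_⟩
  -- If the journey enters `w` by its last edge, it was at `y` just before; otherwise that edge is
  -- appended.
  rcases hle.eq_or_lt with rfl | hlt
  · obtain rfl := hE _ _ _ _ he he'
    exact ⟨s', n', J, by omega⟩
  · exact ⟨_, _, h.step he hlt, le_rfl⟩

/-- A spanner contains the core of a spanner that is not larger, and the core is small. -/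
theorem Connects.exists_core [Fintype V] [DecidableEq V] [Nontrivial V] {X : Finset V}
    (hEG : E ⊆ G) (hG : ProperEdges G) (hX : ∀ a b l, (s(a, b), l) ∈ G → a ∈ X ∨ b ∈ X)
    (hE : Connects E) :
    ∃ (F : Finset (Sym2 V × ℕ)) (P Q : Finset (V × ℕ)),
      F.card ≤ 4 * X.card ^ 2 ∧ P.card ≤ 2 * X.card ∧ Q.card ≤ 2 * X.card ∧
      (∀ x τ, (x, τ) ∈ P → τ = 0 ∨ ∃ e, (e, τ) ∈ E) ∧ (∀ y θ, (y, θ) ∈ Q → ∃ e, (e, θ) ∈ E) ∧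
      F ⊆ E ∧
      (∀ x τ y θ, (x, τ) ∈ P → (y, θ) ∈ Q →
        τ ≤ θ ∧ ∃ s n, Journey F x τ y s n ∧ s ≤ θ + 1 ∧ n ≤ 2 * X.card) ∧
      (∀ v, OutGood (P : Set (V × ℕ)) G v) ∧ (∀ v, InGood (Q : Set (V × ℕ)) G v) ∧
      F.card + ∑ v, missing G F P Q v ≤ E.card := by
  classical
  have hEp := hG.mono hEG
  have hXE : ∀ a b l, (s(a, b), l) ∈ E → a ∈ X ∨ b ∈ X := fun a b l h => hX a b l (hEG h)
  choose fx ft hf hfmin using hE.exists_first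
  choose lx lt hl hlmax using hE.exists_last
  obtain ⟨θm, hθm, hmax⟩ : ∃ θ, (∃ e, (e, θ) ∈ E) ∧ ∀ e t, (e, t) ∈ E → t ≤ θ := by
    obtain ⟨v⟩ : Nonempty V := inferInstance
    obtain ⟨e, he, h⟩ := E.exists_max_image (fun e => e.2) ⟨_, hf v⟩
    exact ⟨e.2, ⟨e.1, he⟩, fun e' t h' => h (e', t) h'⟩
  -- `τ x` is the maximum of the first labels of the vertices attached to `x`, or `0` if there are
  -- none. The vertex attaining it shows that leaving `x` this late still suffices.
  have hτ : ∀ x, ∃ τ, (τ = 0 ∨ ∃ e, (e, τ) ∈ E) ∧ (∀ v ∉ X, fx v = x → ft v ≤ τ) ∧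
      ∀ y, ∃ s n, Journey E x τ y s n := by
    intro x
    rcases (Finset.univ.filter fun v => v ∉ X ∧ fx v = x).eq_empty_or_nonempty with h | h
    · refine ⟨0, .inl rfl, fun v hv hx => ?_, hE x⟩
      exact absurd ⟨hv, hx⟩ (Finset.filter_eq_empty_iff.1 h (Finset.mem_univ v))
    · obtain ⟨v, hv, hvmax⟩ := Finset.exists_max_image _ ft h
      obtain ⟨-, hvX, hvx⟩ := Finset.mem_filter.1 hv
      have he := hf v
      rw [hvx] at he
      refine ⟨ft v, .inr ⟨_, he⟩, fun v' hv' hx' => hvmax v' (by simp [hv', hx']), fun y => ?_⟩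
      obtain ⟨s, n, J⟩ := hE v y
      rcases J.of_first hEp he (hfmin v) with rfl | ⟨s', n', -, J'⟩
      · exact ⟨_, _, Journey.refl.step (by rwa [Sym2.eq_swap]) le_rfl⟩
      · exact ⟨s', n', J'⟩
  choose τ hτl hτmax hτJ using hτ
  -- Dually, `θ y` is the minimum of the last labels, or the largest label overall. The minimizing
  -- vertex lies outside `X`, so it differs from the starting point `x`, as `Journey.of_last`
  -- requires.
  have hθ : ∀ y, ∃ θ, (∃ e, (e, θ) ∈ E) ∧ (∀ v ∉ X, lx v = y → θ ≤ lt v) ∧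
      ∀ x ∈ X, ∀ t, (t = 0 ∨ ∃ e, (e, t) ∈ E) → (∀ z, ∃ s n, Journey E x t z s n) →
        t ≤ θ ∧ ∃ s n, Journey E x t y s n ∧ s ≤ θ + 1 := by
    intro y
    rcases (Finset.univ.filter fun v => v ∉ X ∧ lx v = y).eq_empty_or_nonempty with h | h
    · refine ⟨θm, hθm, fun v hv hx => ?_, fun x hx t ht hJ => ?_⟩
      · exact absurd ⟨hv, hx⟩ (Finset.filter_eq_empty_iff.1 h (Finset.mem_univ v))
      · have htm : t ≤ θm := by
          rcases ht with rfl | ⟨e, he⟩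
          · exact Nat.zero_le _
          · exact hmax _ _ he
        obtain ⟨s, n, J⟩ := hJ y
        refine ⟨htm, s, n, J, ?_⟩
        cases J with
        | refl => omega
        | step _ he _ => have := hmax _ _ he; omega
    · obtain ⟨w, hw, hwmin⟩ := Finset.exists_min_image _ lt h
      obtain ⟨-, hwX, hwy⟩ := Finset.mem_filter.1 hw
      have he := hl w
      rw [hwy] at he
      refine ⟨lt w, ⟨_, he⟩, fun v' hv' hx' => hwmin v' (by simp [hv', hx']),
        fun x hx t _ hJ => ?_⟩
      obtain ⟨s, n, J⟩ := hJ w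
      exact J.of_last hEp he (hlmax w) fun h => hwX (h ▸ hx)
  choose θ hθl hθmin hθJ using hθ
  -- The points `(x, 0)` and `(y, θm)` make each cover vertex a departure and an arrival point
  -- itself, so that it needs no attaching edges.
  let P := X.image (fun x => (x, 0)) ∪ X.image (fun x => (x, τ x))
  let Q := X.image (fun y => (y, θm)) ∪ X.image (fun y => (y, θ y))
  have hP : ∀ x t, (x, t) ∈ P → x ∈ X ∧ (t = 0 ∨ ∃ e, (e, t) ∈ E) ∧
      ∀ z, ∃ s n, Journey E x t z s n := by
    intro x t h
    rcases Finset.mem_union.1 h with h | h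
    · obtain ⟨x', hx', h'⟩ := Finset.mem_image.1 h
      obtain ⟨rfl, rfl⟩ := Prod.mk.inj h'
      exact ⟨hx', .inl rfl, hE _⟩
    · obtain ⟨x', hx', h'⟩ := Finset.mem_image.1 h
      obtain ⟨rfl, rfl⟩ := Prod.mk.inj h'
      exact ⟨hx', hτl _, hτJ _⟩
  have hQ : ∀ y t, (y, t) ∈ Q → y ∈ X ∧ (∃ e, (e, t) ∈ E) ∧ ∀ x ∈ X, ∀ t',
      (t' = 0 ∨ ∃ e, (e, t') ∈ E) → (∀ z, ∃ s n, Journey E x t' z s n) →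
        t' ≤ t ∧ ∃ s n, Journey E x t' y s n ∧ s ≤ t + 1 := by
    intro y t h
    rcases Finset.mem_union.1 h with h | h
    · obtain ⟨y', hy', h'⟩ := Finset.mem_image.1 h
      obtain ⟨rfl, rfl⟩ := Prod.mk.inj h'
      refine ⟨hy', hθm, fun x hx t' ht' hJ => ?_⟩
      obtain ⟨h₁, s, n, J, hs⟩ := hθJ y' x hx t' ht' hJ
      obtain ⟨e, he⟩ := hθl y'
      have := hmax _ _ he
      exact ⟨by omega, s, n, J, by omega⟩
    · obtain ⟨y', hy', h'⟩ := Finset.mem_image.1 h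
      obtain ⟨rfl, rfl⟩ := Prod.mk.inj h'
      exact ⟨hy', hθl _, hθJ _⟩
  have hPcard : P.card ≤ 2 * X.card := by
    refine (Finset.card_union_le _ _).trans ?_
    have h₁ := Finset.card_image_le (s := X) (f := fun x => (x, 0))
    have h₂ := Finset.card_image_le (s := X) (f := fun x => (x, τ x))
    omega
  have hQcard : Q.card ≤ 2 * X.card := by
    refine (Finset.card_union_le _ _).trans ?_
    have h₁ := Finset.card_image_le (s := X) (f := fun y => (y, θm))
    have h₂ := Finset.card_image_le (s := X) (f := fun y => (y, θ y))
    omega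
  have htree : ∀ p : V × ℕ, ∃ F ⊆ E, F.card ≤ 2 * X.card ∧ (p ∈ P → ∀ y ∈ X, ∀ s n,
      Journey E p.1 p.2 y s n →
        ∃ s' n', s' ≤ s ∧ n' ≤ 2 * X.card ∧ Journey F p.1 p.2 y s' n') := by
    intro p
    by_cases h : p ∈ P
    · obtain ⟨F, h₁, h₂, h₃⟩ := exists_foremost_tree hXE (hP p.1 p.2 h).2.2
      exact ⟨F, h₁, h₂, fun _ => h₃⟩
    · exact ⟨∅, by simp, by simp, fun h' => absurd h' h⟩
  choose T hTE hTcard hTJ using htree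
  let F := P.biUnion T
  have hFE : F ⊆ E := Finset.biUnion_subset.2 fun p _ => hTE p
  have hXP : ∀ v ∈ X, (v, 0) ∈ P := fun v hv =>
    Finset.mem_union_left _ (Finset.mem_image_of_mem (fun x => (x, 0)) hv)
  have hXQ : ∀ v ∈ X, (v, θm) ∈ Q := fun v hv =>
    Finset.mem_union_left _ (Finset.mem_image_of_mem (fun x => (x, θm)) hv)
  have hout : ∀ v ∉ X, OutEdge (P : Set (V × ℕ)) v (s(v, fx v), ft v) := fun v hv =>
    ⟨fx v, τ (fx v), Finset.mem_union_right _ (Finset.mem_image_of_mem (fun x => (x, τ x))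
      ((hXE _ _ _ (hf v)).resolve_left hv)), rfl, hτmax _ v hv rfl⟩
  have hin : ∀ v ∉ X, InEdge (Q : Set (V × ℕ)) v (s(v, lx v), lt v) := fun v hv =>
    ⟨lx v, θ (lx v), Finset.mem_union_right _ (Finset.mem_image_of_mem (fun x => (x, θ x))
      ((hXE _ _ _ (hl v)).resolve_left hv)), rfl, hθmin _ v hv rfl⟩
  refine ⟨F, P, Q, ?_, hPcard, hQcard, fun x t h => (hP x t h).2.1, fun y t h => (hQ y t h).2.1,
    hFE, fun x t y t' hx hy => ?_, fun v => ?_, fun v => ?_, ?_⟩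
  · calc F.card ≤ P.card * (2 * X.card) := Finset.card_biUnion_le_card_mul _ _ _ fun p _ => hTcard p
      _ ≤ 2 * X.card * (2 * X.card) := Nat.mul_le_mul_right _ hPcard
      _ = _ := by ring
  · obtain ⟨hxX, ht, hJ⟩ := hP x t hx
    obtain ⟨hyX, -, hJ'⟩ := hQ y t' hy
    obtain ⟨h₁, s, n, J, hs⟩ := hJ' x hxX t ht hJ
    obtain ⟨s', n', hs', hn', J'⟩ := hTJ (x, t) hx y hyX s n J
    exact ⟨h₁, s', n', J'.mono (Finset.subset_biUnion_of_mem T hx), by omega, hn'⟩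
  · by_cases hv : v ∈ X
    · exact .inl ⟨0, hXP v hv⟩
    · exact .inr ⟨_, hEG (hf v), hout v hv⟩
  · by_cases hv : v ∈ X
    · exact .inl ⟨θm, hXQ v hv⟩
    · exact .inr ⟨_, hEG (hl v), hin v hv⟩
  -- If `v` is not attached by `F`, then its first or its last edge is absent from `F`. If two edges
  -- are missing, then both are absent and they differ, since one common edge would serve both
  -- purposes.
  · have hmiss : ∀ v, missing G F P Q v ≤ if v ∈ X then 0 else
        ((E \ F).filter fun e => v ∈ e.1).card := by
      intro v
      split_ifs with hv
      · rw [missing, if_pos ⟨.inl ⟨0, hXP v hv⟩, .inl ⟨θm, hXQ v hv⟩⟩]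
      set N := (E \ F).filter fun e => v ∈ e.1
      have hN₁ : (s(v, fx v), ft v) ∉ F → (s(v, fx v), ft v) ∈ N := fun h => by
        simp [N, h, hf v]
      have hN₂ : (s(v, lx v), lt v) ∉ F → (s(v, lx v), lt v) ∈ N := fun h => by
        simp [N, h, hl v]
      unfold missing
      split_ifs with h₁ h₂
      · exact Nat.zero_le _
      · rcases not_and_or.1 h₁ with h | h
        · exact Finset.card_pos.2 ⟨_, hN₁ fun h' => h (.inr ⟨_, h', hout v hv⟩)⟩
        · exact Finset.card_pos.2 ⟨_, hN₂ fun h' => h (.inr ⟨_, h', hin v hv⟩)⟩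
      · push Not at h₂
        have h₃ := hN₁ fun h' => h₂.1 (.inr ⟨_, h', hout v hv⟩)
        have h₄ := hN₂ fun h' => h₂.2.1 (.inr ⟨_, h', hin v hv⟩)
        refine Finset.one_lt_card.2 ⟨_, h₃, _, h₄, fun h => ?_⟩
        exact h₂.2.2 _ (hEG (hf v)) (hout v hv) (h ▸ hin v hv)
    have hsum : ∑ v, missing G F P Q v ≤ (E \ F).card := by
      calc ∑ v, missing G F P Q v
          ≤ ∑ v, if v ∈ X then 0 else ((E \ F).filter fun e => v ∈ e.1).card :=
            Finset.sum_le_sum fun v _ => hmiss v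
        _ = ∑ v ∈ Xᶜ, ((E \ F).filter fun e => v ∈ e.1).card := by
            rw [← Finset.sum_filter_add_sum_filter_not Finset.univ (· ∈ X)]
            rw [Finset.sum_eq_zero (by intro v hv; simp [(Finset.mem_filter.1 hv).2]), zero_add]
            refine Finset.sum_congr (by ext; simp) fun v hv => ?_
            simp [Finset.mem_compl.1 hv]
        _ = (Xᶜ.biUnion fun v => (E \ F).filter fun e => v ∈ e.1).card := by
            -- An edge counted at two vertices outside `X` would have both ends outside the cover.
            refine (Finset.card_biUnion fun v hv v' hv' hne => ?_).symm
            rw [Function.onFun, Finset.disjoint_left]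
            rintro ⟨e, t⟩ h₁ h₂
            obtain ⟨h₁, h₁'⟩ := Finset.mem_filter.1 h₁
            obtain ⟨-, h₂'⟩ := Finset.mem_filter.1 h₂
            obtain rfl := (Sym2.mem_and_mem_iff hne).1 ⟨h₁', h₂'⟩
            rcases hXE _ _ _ (Finset.mem_sdiff.1 h₁).1 with h | h
            · exact (Finset.mem_compl.1 hv) h
            · exact (Finset.mem_compl.1 hv') h
        _ ≤ (E \ F).card := Finset.card_le_card (Finset.biUnion_subset.2 fun v _ =>
            Finset.filter_subset _ _)
    have := Finset.card_sdiff_add_card_eq_card hFE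
    omega

end Completeness

/-! ### The search for a core -/

namespace RamInput

variable (I : RamInput)

/-- The number `e` is the index of a time edge. -/
def IsEdge (e : ℕ) : Prop := 3 + (e + (e + e)) < I.len

/-- One endpoint of the edge number `e`. -/
def src (e : ℕ) : ℕ := I.arr (3 + (e + (e + e)))

/-- The other endpoint of the edge number `e`. -/
def tgt (e : ℕ) : ℕ := I.arr (4 + (e + (e + e)))

/-- The label of the edge number `e`. -/
def label (e : ℕ) : ℕ := I.arr (5 + (e + (e + e)))

/-- The edge number `e` joins `u` and `v`. -/
def Joins (e u v : ℕ) : Prop :=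
  I.src e = u ∧ I.tgt e = v ∨ I.src e = v ∧ I.tgt e = u

/-- The number `x` belongs to the list encoded by `c`. -/
def Listed (c x : ℕ) : Prop := ∃ j < I.bound, I.digit c j = x + 1

/-- `e` is an edge of the core encoded by `c`. -/
def InCore (c e : ℕ) : Prop := I.IsEdge e ∧ I.Listed c e

/-- The edge `e` leads from `v` to an entry of the list encoded by `c` and `d` in time. -/
def OutStep (c d v e : ℕ) : Prop :=
  ∃ j < I.bound, 0 < I.digit c j ∧ I.Joins e v (I.digit c j - 1) ∧
    I.label e ≤ I.label (I.digit d j)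

/-- The edge `e` leads from an entry of the list encoded by `c` and `d` to `v` in time. -/
def InStep (c d v e : ℕ) : Prop :=
  ∃ j < I.bound, 0 < I.digit c j ∧ I.Joins e v (I.digit c j - 1) ∧
    I.label (I.digit d j) ≤ I.label e

/-- The numerical version of `OutGood` for the whole graph. -/
def OutAll (c d v : ℕ) : Prop :=
  I.Listed c v ∨ ∃ e < I.bound, I.IsEdge e ∧ I.OutStep c d v e

/-- The numerical version of `InGood` for the whole graph. -/
def InAll (c d v : ℕ) : Prop :=
  I.Listed c v ∨ ∃ e < I.bound, I.IsEdge e ∧ I.InStep c d v e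

/-- The numerical version of `OutGood` for the core. -/
def OutCore (f c d v : ℕ) : Prop :=
  I.Listed c v ∨ ∃ e < I.bound, I.InCore f e ∧ I.OutStep c d v e

/-- The numerical version of `InGood` for the core. -/
def InnCore (f c d v : ℕ) : Prop :=
  I.Listed c v ∨ ∃ e < I.bound, I.InCore f e ∧ I.InStep c d v e

/-- Some edge leads from `v` to an entry of the first list and from an entry of the second list
to `v`. -/
def BothStep (c d a b v : ℕ) : Prop :=
  ∃ e < I.bound, I.IsEdge e ∧ I.OutStep c d v e ∧ I.InStep a b v e

/-- The numerical version of `missing`. -/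
noncomputable def lacking (f c d c' d' v : ℕ) : ℕ :=
  open Classical in
  if I.OutCore f c d v ∧ I.InnCore f c' d' v then 0
  else if I.OutCore f c d v ∨ I.InnCore f c' d' v ∨ I.BothStep c d c' d' v then 1
  else 2

/-- The codes `cv` and `ce` describe a journey of length `k` in the core. -/
def IsRoute (f τ θ k cv ce : ℕ) : Prop :=
  ∀ i < I.bound, i < k → I.InCore f (I.digit ce i) ∧
    I.Joins (I.digit ce i) (I.digit cv i) (I.digit cv (i + 1)) ∧
    τ ≤ I.label (I.digit ce i) ∧ I.label (I.digit ce i) ≤ θ ∧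
    (i + 1 < k → I.label (I.digit ce i) < I.label (I.digit ce (i + 1)))

/-- The core has a journey from `x` to `y` between the times `τ` and `θ`. -/
def Linked (f x τ y θ : ℕ) : Prop :=
  τ ≤ θ ∧ ∃ k < I.bound, ∃ cv < I.bound, ∃ ce < I.bound,
    I.digit cv 0 = x ∧ I.digit cv k = y ∧ I.IsRoute f τ θ k cv ce

/-- All entries of the two lists are linked. -/
def AllLinked (f c d a b : ℕ) : Prop :=
  ∀ j < I.bound, ∀ i < I.bound, 0 < I.digit c j → 0 < I.digit a i →
    I.Linked f (I.digit c j - 1) (I.label (I.digit d j)) (I.digit a i - 1) (I.label (I.digit b i))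

/-- Every vertex can be attached. -/
def AllAttached (c d a b : ℕ) : Prop :=
  ∀ v < I.bound, v < I.arr 0 → I.OutAll c d v ∧ I.InAll a b v

/-- The size of the spanner obtained from a core. -/
noncomputable def spannerSize (f c d c' d' : ℕ) : ℕ :=
  (∑ e ∈ Finset.range I.bound, indicator (I.InCore f e)) +
    ∑ v ∈ Finset.range I.bound, open Classical in if v < I.arr 0 then I.lacking f c d c' d' v else 0

/-- There is a core that can be completed to a small spanner. -/
def Accepts : Prop :=
  I.arr 0 < 2 ∨ ∃ f < I.bound, ∃ c < I.bound, ∃ d < I.bound, ∃ c' < I.bound, ∃ d' < I.bound,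
    I.AllLinked f c d c' d' ∧ I.AllAttached c d c' d' ∧ I.spannerSize f c d c' d' ≤ I.arr 2

/-- There is a vertex cover whose size is the level. -/
def HasCover : Prop :=
  ∃ c < I.bound, ∀ e < I.bound, I.IsEdge e → ∃ j < I.bound, j < I.level ∧
    (I.digit c j = I.src e ∨ I.digit c j = I.tgt e)

end RamInput

/-! ### The search predicates are easy -/

section Search

variable {Γ : Type} [RamContext Γ] {h : Γ → RamInput} {f c d c' d' e u v x y τ θ k cv ce : Γ → ℕ}

theorem EasyPred.isEdge (hh : Easy h) (he : Easy e) : EasyPred fun x => (h x).IsEdge (e x) :=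
  .lt (.add (.const 3) (.add he (.add he he))) hh.len

theorem Easy.src (hh : Easy h) (he : Easy e) : Easy fun x => (h x).src (e x) :=
  hh.get (.add (.const 3) (.add he (.add he he)))

theorem Easy.tgt (hh : Easy h) (he : Easy e) : Easy fun x => (h x).tgt (e x) :=
  hh.get (.add (.const 4) (.add he (.add he he)))

theorem Easy.label (hh : Easy h) (he : Easy e) : Easy fun x => (h x).label (e x) :=
  hh.get (.add (.const 5) (.add he (.add he he)))

theorem EasyPred.joins (hh : Easy h) (he : Easy e) (hu : Easy u) (hv : Easy v) :
    EasyPred fun x => (h x).Joins (e x) (u x) (v x) :=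
  .or (.and (.eq (hh.src he) hu) (.eq (hh.tgt he) hv))
    (.and (.eq (hh.src he) hv) (.eq (hh.tgt he) hu))

theorem EasyPred.listed (hh : Easy h) (hc : Easy c) (hx : Easy x) :
    EasyPred fun y => (h y).Listed (c y) (x y) := by
  unfold RamInput.Listed
  repeat' with_reducible first
    | assumption | apply EasyPred.bex | apply EasyPred.eq | apply Easy.digit | apply Easy.add
    | apply Easy.const | apply hh.comp | apply hc.comp | apply hx.comp | apply Easy.fst
    | apply Easy.snd | exact Easy.id

theorem EasyPred.inCore (hh : Easy h) (hf : Easy f) (he : Easy e) :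
    EasyPred fun z => (h z).InCore (f z) (e z) := by
  unfold RamInput.InCore
  repeat' with_reducible first
    | assumption | apply EasyPred.and | apply EasyPred.isEdge | apply EasyPred.listed

theorem EasyPred.outStep (hh : Easy h) (hc : Easy c) (hd : Easy d) (hv : Easy v) (he : Easy e) :
    EasyPred fun z => (h z).OutStep (c z) (d z) (v z) (e z) := by
  unfold RamInput.OutStep
  repeat' with_reducible first
    | assumption | apply EasyPred.bex | apply EasyPred.and | apply EasyPred.lt | apply EasyPred.le
    | apply EasyPred.joins | apply Easy.digit | apply Easy.label | apply Easy.sub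
    | apply Easy.const | apply hh.comp | apply hc.comp | apply hd.comp | apply hv.comp
    | apply he.comp | apply Easy.fst | apply Easy.snd | exact Easy.id

theorem EasyPred.inStep (hh : Easy h) (hc : Easy c) (hd : Easy d) (hv : Easy v) (he : Easy e) :
    EasyPred fun z => (h z).InStep (c z) (d z) (v z) (e z) := by
  unfold RamInput.InStep
  repeat' with_reducible first
    | assumption | apply EasyPred.bex | apply EasyPred.and | apply EasyPred.lt | apply EasyPred.le
    | apply EasyPred.joins | apply Easy.digit | apply Easy.label | apply Easy.sub
    | apply Easy.const | apply hh.comp | apply hc.comp | apply hd.comp | apply hv.comp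
    | apply he.comp | apply Easy.fst | apply Easy.snd | exact Easy.id

theorem EasyPred.outAll (hh : Easy h) (hc : Easy c) (hd : Easy d) (hv : Easy v) :
    EasyPred fun z => (h z).OutAll (c z) (d z) (v z) := by
  unfold RamInput.OutAll
  repeat' with_reducible first
    | assumption | apply EasyPred.or | apply EasyPred.listed | apply EasyPred.bex
    | apply EasyPred.and | apply EasyPred.isEdge | apply EasyPred.outStep | apply hh.comp
    | apply hc.comp | apply hd.comp | apply hv.comp | apply Easy.fst | apply Easy.snd
    | exact Easy.id

theorem EasyPred.inAll (hh : Easy h) (hc : Easy c) (hd : Easy d) (hv : Easy v) :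
    EasyPred fun z => (h z).InAll (c z) (d z) (v z) := by
  unfold RamInput.InAll
  repeat' with_reducible first
    | assumption | apply EasyPred.or | apply EasyPred.listed | apply EasyPred.bex
    | apply EasyPred.and | apply EasyPred.isEdge | apply EasyPred.inStep | apply hh.comp
    | apply hc.comp | apply hd.comp | apply hv.comp | apply Easy.fst | apply Easy.snd
    | exact Easy.id

theorem EasyPred.outCore (hh : Easy h) (hf : Easy f) (hc : Easy c) (hd : Easy d) (hv : Easy v) :
    EasyPred fun z => (h z).OutCore (f z) (c z) (d z) (v z) := by
  unfold RamInput.OutCore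
  repeat' with_reducible first
    | assumption | apply EasyPred.or | apply EasyPred.listed | apply EasyPred.bex
    | apply EasyPred.and | apply EasyPred.inCore | apply EasyPred.outStep | apply hh.comp
    | apply hf.comp | apply hc.comp | apply hd.comp | apply hv.comp | apply Easy.fst
    | apply Easy.snd | exact Easy.id

theorem EasyPred.innCore (hh : Easy h) (hf : Easy f) (hc : Easy c) (hd : Easy d) (hv : Easy v) :
    EasyPred fun z => (h z).InnCore (f z) (c z) (d z) (v z) := by
  unfold RamInput.InnCore
  repeat' with_reducible first
    | assumption | apply EasyPred.or | apply EasyPred.listed | apply EasyPred.bex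
    | apply EasyPred.and | apply EasyPred.inCore | apply EasyPred.inStep | apply hh.comp
    | apply hf.comp | apply hc.comp | apply hd.comp | apply hv.comp | apply Easy.fst
    | apply Easy.snd | exact Easy.id

theorem EasyPred.bothStep (hh : Easy h) (hc : Easy c) (hd : Easy d) (hc' : Easy c') (hd' : Easy d')
    (hv : Easy v) :
    EasyPred fun z => (h z).BothStep (c z) (d z) (c' z) (d' z) (v z) := by
  unfold RamInput.BothStep
  repeat' with_reducible first
    | assumption | apply EasyPred.bex | apply EasyPred.and | apply EasyPred.isEdge
    | apply EasyPred.outStep | apply EasyPred.inStep | apply hh.comp | apply hc.comp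
    | apply hd.comp | apply hc'.comp | apply hd'.comp | apply hv.comp | apply Easy.fst
    | apply Easy.snd | exact Easy.id

theorem Easy.lacking (hh : Easy h) (hf : Easy f) (hc : Easy c) (hd : Easy d) (hc' : Easy c')
    (hd' : Easy d') (hv : Easy v) :
    Easy fun z => (h z).lacking (f z) (c z) (d z) (c' z) (d' z) (v z) := by
  unfold RamInput.lacking
  have h₁ := EasyPred.outCore hh hf hc hd hv
  have h₂ := EasyPred.innCore hh hf hc' hd' hv
  exact .ite (.and h₁ h₂) (.const 0)
    (.ite (.or h₁ (.or h₂ (.bothStep hh hc hd hc' hd' hv))) (.const 1) (.const 2))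

theorem EasyPred.isRoute (hh : Easy h) (hf : Easy f) (hτ : Easy τ) (hθ : Easy θ) (hk : Easy k)
    (hcv : Easy cv) (hce : Easy ce) :
    EasyPred fun z => (h z).IsRoute (f z) (τ z) (θ z) (k z) (cv z) (ce z) := by
  unfold RamInput.IsRoute
  repeat' with_reducible first
    | assumption | apply EasyPred.ball | apply EasyPred.imp | apply EasyPred.and
    | apply EasyPred.inCore | apply EasyPred.joins | apply EasyPred.lt | apply EasyPred.le
    | apply Easy.label | apply Easy.digit | apply Easy.add | apply Easy.const | apply hh.comp
    | apply hf.comp | apply hτ.comp | apply hθ.comp | apply hk.comp | apply hcv.comp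
    | apply hce.comp | apply Easy.fst | apply Easy.snd | exact Easy.id

theorem EasyPred.linked (hh : Easy h) (hf : Easy f) (hx : Easy x) (hτ : Easy τ) (hy : Easy y)
    (hθ : Easy θ) :
    EasyPred fun z => (h z).Linked (f z) (x z) (τ z) (y z) (θ z) := by
  unfold RamInput.Linked
  repeat' with_reducible first
    | assumption | apply EasyPred.bex | apply EasyPred.and | apply EasyPred.le | apply EasyPred.eq
    | apply EasyPred.isRoute | apply Easy.digit | apply Easy.const | apply hh.comp | apply hf.comp
    | apply hx.comp | apply hτ.comp | apply hy.comp | apply hθ.comp | apply Easy.fst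
    | apply Easy.snd | exact Easy.id

theorem EasyPred.allLinked (hh : Easy h) (hf : Easy f) (hc : Easy c) (hd : Easy d) (hc' : Easy c')
    (hd' : Easy d') :
    EasyPred fun z => (h z).AllLinked (f z) (c z) (d z) (c' z) (d' z) := by
  unfold RamInput.AllLinked
  repeat' with_reducible first
    | assumption | apply EasyPred.ball | apply EasyPred.imp | apply EasyPred.lt
    | apply EasyPred.linked | apply Easy.digit | apply Easy.label | apply Easy.sub
    | apply Easy.const | apply hh.comp | apply hf.comp | apply hc.comp | apply hd.comp
    | apply hc'.comp | apply hd'.comp | apply Easy.fst | apply Easy.snd | exact Easy.id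

theorem EasyPred.allAttached (hh : Easy h) (hc : Easy c) (hd : Easy d) (hc' : Easy c')
    (hd' : Easy d') :
    EasyPred fun z => (h z).AllAttached (c z) (d z) (c' z) (d' z) := by
  unfold RamInput.AllAttached
  repeat' with_reducible first
    | assumption | apply EasyPred.ball | apply EasyPred.imp | apply EasyPred.and
    | apply EasyPred.lt | apply EasyPred.outAll | apply EasyPred.inAll | apply Easy.get
    | apply Easy.const | apply hh.comp | apply hc.comp | apply hd.comp | apply hc'.comp
    | apply hd'.comp | apply Easy.fst | apply Easy.snd | exact Easy.id

theorem Easy.spannerSize (hh : Easy h) (hf : Easy f) (hc : Easy c) (hd : Easy d) (hc' : Easy c')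
    (hd' : Easy d') :
    Easy fun z => (h z).spannerSize (f z) (c z) (d z) (c' z) (d' z) := by
  unfold RamInput.spannerSize
  have hI := hh.comp (Easy.fst (Easy.id (Γ := Γ × ℕ)))
  have hi := Easy.snd (Easy.id (Γ := Γ × ℕ))
  exact .add (.sum hh (EasyPred.inCore hI (hf.comp (Easy.fst .id)) hi))
    (.sum hh (.ite (.lt hi (hI.get (.const 0)))
      (.lacking hI (hf.comp (Easy.fst .id)) (hc.comp (Easy.fst .id)) (hd.comp (Easy.fst .id))
        (hc'.comp (Easy.fst .id)) (hd'.comp (Easy.fst .id)) hi) (.const 0)))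

theorem EasyPred.accepts (hh : Easy h) :
    EasyPred fun z => (h z).Accepts := by
  unfold RamInput.Accepts
  repeat' with_reducible first
    | assumption | apply EasyPred.or | apply EasyPred.bex | apply EasyPred.and
    | apply EasyPred.allLinked | apply EasyPred.allAttached | apply EasyPred.le
    | apply EasyPred.lt | apply Easy.spannerSize | apply Easy.get | apply Easy.const
    | apply hh.comp | apply Easy.fst | apply Easy.snd | exact Easy.id

theorem EasyPred.hasCover (hh : Easy h) :
    EasyPred fun z => (h z).HasCover := by
  unfold RamInput.HasCover
  repeat' with_reducible first
    | assumption | apply EasyPred.ball | apply EasyPred.bex | apply EasyPred.imp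
    | apply EasyPred.and | apply EasyPred.or | apply EasyPred.eq | apply EasyPred.lt
    | apply EasyPred.isEdge | apply Easy.digit | apply Easy.src | apply Easy.tgt
    | apply Easy.level | apply hh.comp | apply Easy.fst | apply Easy.snd | exact Easy.id

end Search

/-! ### Correctness of the search -/

/-- Unrolls a journey into a vertex sequence and a label sequence, the form in which it can be
written as digits. -/
theorem Journey.exists_route {V : Type} {E : Finset (Sym2 V × ℕ)} {x y : V} {τ s n : ℕ}
    (h : Journey E x τ y s n) :
    ∃ (vf : ℕ → V) (lf : ℕ → ℕ), vf 0 = x ∧ vf n = y ∧ ∀ i < n,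
      (s(vf i, vf (i + 1)), lf i) ∈ E ∧ τ ≤ lf i ∧ lf i < s ∧ (i + 1 < n → lf i < lf (i + 1)) := by
  induction h with
  | refl => exact ⟨fun _ => x, fun _ => 0, rfl, rfl, by simp⟩
  | @step u v s l n J he hs ih =>
    obtain ⟨vf, lf, h0, hn, H⟩ := ih
    refine ⟨fun i => if i ≤ n then vf i else v, fun i => if i < n then lf i else l, by simp [h0],
      by simp, fun i hi => ?_⟩
    rcases (Nat.lt_succ_iff.1 hi).lt_or_eq with hi | rfl
    · obtain ⟨h₁, h₂, h₃, h₄⟩ := H i hi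
      simp only [hi, hi.le, Nat.succ_le_of_lt hi, if_true]
      refine ⟨h₁, h₂, by omega, fun _ => ?_⟩
      split_ifs with h₅
      · exact h₄ h₅
      · omega
    · simp only [le_refl, lt_irrefl, if_true, if_false, hn]
      refine ⟨?_, J.le.trans hs, by omega, fun h => h.elim⟩
      simpa using he

namespace RamInput

/-- The input describes a graph with the time edges `ed 0, …, ed (m - 1)`. -/
structure Represents (I : RamInput) {n : ℕ} (m : ℕ) (G : Finset (Sym2 (Fin n) × ℕ))
    (ed : ℕ → Sym2 (Fin n) × ℕ) : Prop where
  order : I.arr 0 = n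
  len : I.len = 3 * m + 3
  mem : ∀ e < m, ed e ∈ G
  surj : ∀ g ∈ G, ∃ e < m, ed e = g
  inj : ∀ e < m, ∀ e' < m, ed e = ed e' → e = e'
  label : ∀ e < m, I.label e = (ed e).2
  joins : ∀ e < m, ∀ u v : Fin n, I.Joins e u v ↔ (ed e).1 = s(u, v)
  joins_lt : ∀ e < m, ∀ a b, I.Joins e a b → a < n ∧ b < n
  label_out : I.label m = 0
  order_lt : n < I.base
  base_le : I.base ≤ I.bound

/-- The set of pairs of a vertex and a time that is encoded by `c` and `d`. -/
def points (I : RamInput) (n c d : ℕ) : Set (Fin n × ℕ) :=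
  {p | ∃ j < I.bound, I.digit c j = p.1 + 1 ∧ I.label (I.digit d j) = p.2}

open Classical in
/-- The core that is encoded by `f`. -/
noncomputable def core (I : RamInput) {n : ℕ} (m : ℕ) (ed : ℕ → Sym2 (Fin n) × ℕ) (f : ℕ) :
    Finset (Sym2 (Fin n) × ℕ) :=
  ((Finset.range m).filter (I.Listed f)).image ed

theorem mem_core {I : RamInput} {n m : ℕ} {ed : ℕ → Sym2 (Fin n) × ℕ} {f : ℕ}
    {g : Sym2 (Fin n) × ℕ} : g ∈ I.core m ed f ↔ ∃ e < m, I.Listed f e ∧ ed e = g := by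
  simp [core, and_assoc]

/-! ### From codes to cores and back -/

namespace Represents

variable {I : RamInput} {n m : ℕ} {G : Finset (Sym2 (Fin n) × ℕ)} {ed : ℕ → Sym2 (Fin n) × ℕ}
  {f c d c' d' : ℕ}

theorem isEdge_iff (h : I.Represents m G ed) {e : ℕ} : I.IsEdge e ↔ e < m := by
  unfold IsEdge
  rw [h.len]
  omega

theorem size_lt_bound (h : I.Represents m G ed) : m < I.bound := by
  have h₁ := h.base_le
  have h₂ := h.len
  unfold base at h₁
  omega

theorem core_subset (h : I.Represents m G ed) : I.core m ed f ⊆ G := by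
  intro g hg
  obtain ⟨e, he, -, rfl⟩ := mem_core.1 hg
  exact h.mem e he

theorem inCore_iff (h : I.Represents m G ed) {e : ℕ} (he : e < m) :
    I.InCore f e ↔ ed e ∈ I.core m ed f := by
  rw [InCore, h.isEdge_iff, mem_core]
  constructor
  · rintro ⟨h₁, h₂⟩
    exact ⟨e, h₁, h₂, rfl⟩
  · rintro ⟨e', h₁, h₂, h₃⟩
    rw [← h.inj _ h₁ _ he h₃]
    exact ⟨h₁, h₂⟩

/-- Vertices in a list are shifted by one, digit `0` meaning no entry; `joins_lt` guarantees that
the decoded number is a vertex. -/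
theorem outStep_iff (h : I.Represents m G ed) {e : ℕ} (he : e < m) (v : Fin n) :
    I.OutStep c d v e ↔ OutEdge (I.points n c d) v (ed e) := by
  constructor
  · rintro ⟨j, hj, h₀, h₁, h₂⟩
    refine ⟨⟨_, (h.joins_lt e he _ _ h₁).2⟩, _, ⟨j, hj, ?_, rfl⟩, (h.joins e he _ _).1 h₁,
      h.label e he ▸ h₂⟩
    simp only
    omega
  · rintro ⟨x, τ, ⟨j, hj, hx, rfl⟩, h₁, h₂⟩
    refine ⟨j, hj, by simp [hx], ?_, by rwa [h.label e he]⟩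
    rw [hx, Nat.add_sub_cancel]
    exact (h.joins e he _ _).2 h₁

theorem inStep_iff (h : I.Represents m G ed) {e : ℕ} (he : e < m) (v : Fin n) :
    I.InStep c d v e ↔ InEdge (I.points n c d) v (ed e) := by
  constructor
  · rintro ⟨j, hj, h₀, h₁, h₂⟩
    refine ⟨⟨_, (h.joins_lt e he _ _ h₁).2⟩, _, ⟨j, hj, ?_, rfl⟩, (h.joins e he _ _).1 h₁,
      h.label e he ▸ h₂⟩
    simp only
    omega
  · rintro ⟨x, τ, ⟨j, hj, hx, rfl⟩, h₁, h₂⟩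
    refine ⟨j, hj, by simp [hx], ?_, by rwa [h.label e he]⟩
    rw [hx, Nat.add_sub_cancel]
    exact (h.joins e he _ _).2 h₁

theorem listed_iff (v : Fin n) : I.Listed c v ↔ ∃ τ, (v, τ) ∈ I.points n c d :=
  ⟨fun ⟨j, hj, h⟩ => ⟨_, j, hj, h, rfl⟩, fun ⟨_, j, hj, h, _⟩ => ⟨j, hj, h⟩⟩

theorem exists_edge_iff (h : I.Represents m G ed) {p : ℕ → Prop} {q : Sym2 (Fin n) × ℕ → Prop}
    (hpq : ∀ e < m, p e ↔ q (ed e)) : (∃ e < I.bound, I.IsEdge e ∧ p e) ↔ ∃ g ∈ G, q g := by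
  constructor
  · rintro ⟨e, -, he, hp⟩
    rw [h.isEdge_iff] at he
    exact ⟨_, h.mem e he, (hpq e he).1 hp⟩
  · rintro ⟨g, hg, hq⟩
    obtain ⟨e, he, rfl⟩ := h.surj g hg
    exact ⟨e, he.trans h.size_lt_bound, h.isEdge_iff.2 he, (hpq e he).2 hq⟩

theorem exists_core_iff (h : I.Represents m G ed) {p : ℕ → Prop} {q : Sym2 (Fin n) × ℕ → Prop}
    (hpq : ∀ e < m, p e ↔ q (ed e)) :
    (∃ e < I.bound, I.InCore f e ∧ p e) ↔ ∃ g ∈ I.core m ed f, q g := by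
  constructor
  · rintro ⟨e, -, he, hp⟩
    have hem := h.isEdge_iff.1 he.1
    exact ⟨_, (h.inCore_iff hem).1 he, (hpq e hem).1 hp⟩
  · rintro ⟨g, hg, hq⟩
    obtain ⟨e, he, -, rfl⟩ := mem_core.1 hg
    exact ⟨e, he.trans h.size_lt_bound, (h.inCore_iff he).2 hg, (hpq e he).2 hq⟩

theorem outAll_iff (h : I.Represents m G ed) (v : Fin n) :
    I.OutAll c d v ↔ OutGood (I.points n c d) G v :=
  or_congr (listed_iff v) (h.exists_edge_iff fun _ he => h.outStep_iff he v)

theorem inAll_iff (h : I.Represents m G ed) (v : Fin n) :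
    I.InAll c d v ↔ InGood (I.points n c d) G v :=
  or_congr (listed_iff v) (h.exists_edge_iff fun _ he => h.inStep_iff he v)

theorem outCore_iff (h : I.Represents m G ed) (v : Fin n) :
    I.OutCore f c d v ↔ OutGood (I.points n c d) (I.core m ed f) v :=
  or_congr (listed_iff v) (h.exists_core_iff fun _ he => h.outStep_iff he v)

theorem innCore_iff (h : I.Represents m G ed) (v : Fin n) :
    I.InnCore f c d v ↔ InGood (I.points n c d) (I.core m ed f) v :=
  or_congr (listed_iff v) (h.exists_core_iff fun _ he => h.inStep_iff he v)

theorem bothStep_iff (h : I.Represents m G ed) (v : Fin n) :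
    I.BothStep c d c' d' v ↔
      ∃ e ∈ G, OutEdge (I.points n c d) v e ∧ InEdge (I.points n c' d') v e :=
  h.exists_edge_iff fun _ he => and_congr (h.outStep_iff he v) (h.inStep_iff he v)

theorem lacking_eq (h : I.Represents m G ed) (v : Fin n) :
    I.lacking f c d c' d' v =
      missing G (I.core m ed f) (I.points n c d) (I.points n c' d') v := by
  unfold lacking missing
  rw [propext (h.outCore_iff v), propext (h.innCore_iff v), propext (h.bothStep_iff v)]
  congr

theorem spannerSize_eq (h : I.Represents m G ed) :
    I.spannerSize f c d c' d' = (I.core m ed f).card +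
      ∑ v, missing G (I.core m ed f) (I.points n c d) (I.points n c' d') v := by
  classical
  unfold spannerSize
  congr 1
  · simp only [indicator_eq_ite, ← Finset.sum_filter, Finset.sum_const, smul_eq_mul, mul_one]
    -- Distinct indices are distinct time edges, so counting listed indices counts the core.
    rw [core, Finset.card_image_of_injOn]
    · congr 1
      ext e
      have := h.size_lt_bound
      simp only [Finset.mem_filter, Finset.mem_range, InCore, h.isEdge_iff]
      constructor
      · rintro ⟨-, h₁, h₂⟩
        exact ⟨h₁, h₂⟩
      · rintro ⟨h₁, h₂⟩
        exact ⟨by omega, h₁, h₂⟩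
    · intro e he e' he' hee
      simp only [Finset.coe_filter, Finset.mem_range, Set.mem_ofPred_eq] at he he'
      exact h.inj e he.1 e' he'.1 hee
  · have hn : n ≤ I.bound := (h.order_lt.le).trans h.base_le
    rw [h.order, ← Finset.sum_filter, show (Finset.range I.bound).filter (· < n) = Finset.range n by
      ext v; simp; omega, Finset.sum_range]
    exact Finset.sum_congr rfl fun v _ => h.lacking_eq v

/-- The route is followed digit by digit, with the ready time never exceeding the next label. -/
theorem journey_of_linked (h : I.Represents m G ed) {x y : Fin n} {τ θ : ℕ}
    (hl : I.Linked f x τ y θ) :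
    τ ≤ θ ∧ ∃ s k, Journey (I.core m ed f) x τ y s k ∧ s ≤ θ + 1 := by
  obtain ⟨hτ, k, hk, cv, hcv, ce, hce, hx, hy, hr⟩ := hl
  refine ⟨hτ, ?_⟩
  have H : ∀ i ≤ k, ∃ (v : Fin n) (s j : ℕ), I.digit cv i = v ∧
      Journey (I.core m ed f) x τ v s j ∧ s ≤ θ + 1 ∧ (i < k → s ≤ I.label (I.digit ce i)) := by
    intro i
    induction i with
    | zero =>
      intro _
      exact ⟨x, τ, 0, hx, .refl, by omega, fun hk => (hr 0 (by omega) hk).2.2.1⟩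
    | succ i ih =>
      intro hi
      obtain ⟨v, s, j, hv, J, hs, hs'⟩ := ih (by omega)
      obtain ⟨h₁, h₂, -, h₄, h₅⟩ := hr i (by omega) hi
      have he := h.isEdge_iff.1 h₁.1
      have hlt := (h.joins_lt _ he _ _ h₂).2
      rw [hv] at h₂
      have h₆ := (h.joins _ he v ⟨_, hlt⟩).1 h₂
      have h₇ := (h.inCore_iff he).1 h₁
      refine ⟨⟨_, hlt⟩, _, _, rfl, J.step (l := I.label (I.digit ce i)) ?_ (hs' hi), by omega, h₅⟩
      rw [h.label _ he, ← h₆]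
      exact h₇
  obtain ⟨v, s, j, hv, J, hs, -⟩ := H k le_rfl
  obtain rfl : v = y := Fin.ext (hv.symm.trans hy)
  exact ⟨s, j, J, hs⟩

/-- A journey with `k` edges has `k + 1` vertices, all of which must fit into one code; hence the
exponent. -/
theorem linked_of_journey (h : I.Represents m G ed) {x y : Fin n} {τ θ s k : ℕ}
    (hk : I.base ^ (k + 1) ≤ I.bound) (hτ : τ ≤ θ) (J : Journey (I.core m ed f) x τ y s k)
    (hs : s ≤ θ + 1) : I.Linked f x τ y θ := by
  obtain ⟨vf, lf, h0, hn, H⟩ := J.exists_route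
  have hbase : 1 < I.base := by simp [base]
  have hbase' : m < I.base := by simp only [base, h.len]; omega
  have hkb : k + 1 < I.bound := (Nat.lt_pow_self hbase).trans_le hk
  have hidx : ∀ i, ∃ e, i < k → e < m ∧ I.Listed f e ∧ ed e = (s(vf i, vf (i + 1)), lf i) := by
    intro i
    by_cases hi : i < k
    · obtain ⟨e, h₁, h₂, h₃⟩ := mem_core.1 (H i hi).1
      exact ⟨e, fun _ => ⟨h₁, h₂, h₃⟩⟩
    · exact ⟨0, fun h => absurd h hi⟩
  choose ef hef using hidx
  obtain ⟨cv, hcv, hdv⟩ := I.exists_digit_eq h.base_le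
    ((List.range (k + 1)).map fun i => (vf i : ℕ)) (by
      simp only [List.mem_map]
      rintro _ ⟨i, -, rfl⟩
      exact (vf i).2.trans h.order_lt) (by simpa using hk)
  obtain ⟨ce, hce, hde⟩ := I.exists_digit_eq h.base_le ((List.range k).map ef) (by
      simp only [List.mem_map, List.mem_range]
      rintro _ ⟨i, hi, rfl⟩
      exact (hef i hi).1.trans hbase')
      (by simpa using (Nat.pow_le_pow_right (by omega) (Nat.le_succ k)).trans hk)
  have hdv' : ∀ i ≤ k, I.digit cv i = vf i := fun i hi => by
    rw [hdv i (by omega), List.getD_eq_getElem _ _ (by simpa using by omega)]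
    simp
  have hde' : ∀ i < k, I.digit ce i = ef i := fun i hi => by
    rw [hde i (by omega), List.getD_eq_getElem _ _ (by simpa using hi)]
    simp
  refine ⟨hτ, k, by omega, cv, hcv, ce, hce, by rw [hdv' 0 (by omega), h0],
    by rw [hdv' k le_rfl, hn], fun i _ hi => ?_⟩
  obtain ⟨h₁, h₂, h₃⟩ := hef i hi
  obtain ⟨-, h₄, h₅, h₆⟩ := H i hi
  have hlab : I.label (ef i) = lf i := by rw [h.label _ h₁, h₃]
  rw [hde' i hi, hdv' i hi.le, hdv' (i + 1) hi, hlab]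
  refine ⟨⟨h.isEdge_iff.2 h₁, h₂⟩, (h.joins _ h₁ _ _).2 (by rw [h₃]), h₄, by omega, fun hik => ?_⟩
  obtain ⟨h₇, -, h₈⟩ := hef (i + 1) hik
  rw [hde' _ hik, h.label _ h₇, h₈]
  exact h₆ hik

/-- If the search succeeds, then there is a small spanner. -/
theorem exists_connects_of_accepts (h : I.Represents m G ed) (hG : ProperEdges G) (hn : 2 ≤ n)
    (ha : I.Accepts) : ∃ H ⊆ G, Connects H ∧ H.card ≤ I.arr 2 := by
  rcases ha with ha | ⟨f, hf, c, hc, d, hd, c', hc', d', hd', h₁, h₂, h₃⟩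
  · rw [h.order] at ha
    omega
  have hcore : SpannerCore G (I.core m ed f) (I.points n c d) (I.points n c' d') := by
    refine ⟨h.core_subset, ?_, fun v => ?_, fun v => ?_⟩
    · rintro x _ y _ ⟨j, hj, hx, rfl⟩ ⟨j', hj', hy, rfl⟩
      have := h₁ j hj j' hj' (by simp [hx]) (by simp [hy])
      simp only at hx hy
      rw [hx, hy, Nat.add_sub_cancel, Nat.add_sub_cancel] at this
      exact h.journey_of_linked this
    · exact (h.outAll_iff v).1 (h₂ v (v.2.trans (h.order_lt.trans_le h.base_le))
        (h.order ▸ v.2)).1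
    · exact (h.inAll_iff v).1 (h₂ v (v.2.trans (h.order_lt.trans_le h.base_le))
        (h.order ▸ v.2)).2
  obtain ⟨H, hHG, hH, hcard⟩ := hcore.exists_connects hG
  rw [h.spannerSize_eq] at h₃
  exact ⟨H, hHG, hH, hcard.trans h₃⟩

/-- Times are stored as indices of edges that carry them, because labels may be arbitrarily large
while indices are below the base. The last clause lets every nonzero digit be decoded as a vertex.
-/
theorem exists_points_eq (h : I.Represents m G ed) (P : Finset (Fin n × ℕ))
    (hP : ∀ x τ, (x, τ) ∈ P → τ = 0 ∨ ∃ e, (e, τ) ∈ G) (hb : I.base ^ P.card ≤ I.bound) :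
    ∃ c < I.bound, ∃ d < I.bound, I.points n c d = P ∧
      ∀ j < I.bound, 0 < I.digit c j → I.digit c j - 1 < n := by
  have hbase' : m < I.base := by simp only [base, h.len]; omega
  have hidx : ∀ p : Fin n × ℕ, ∃ e, p ∈ P → e < I.base ∧ I.label e = p.2 := by
    rintro ⟨x, τ⟩
    by_cases hp : (x, τ) ∈ P
    · rcases hP x τ hp with rfl | ⟨e, he⟩
      -- Time `0` is encoded by the index `m` just past the last edge, where the array reads as
      -- zero.
      · exact ⟨m, fun _ => ⟨hbase', h.label_out⟩⟩
      · obtain ⟨i, hi, hie⟩ := h.surj _ he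
        exact ⟨i, fun _ => ⟨hi.trans hbase', by rw [h.label i hi, hie]⟩⟩
    · exact ⟨0, fun h => absurd h hp⟩
  choose idx hidx using hidx
  obtain ⟨c, hc, hdc⟩ := I.exists_digit_eq h.base_le (P.toList.map fun p => (p.1 : ℕ) + 1) (by
      simp only [List.mem_map]
      rintro _ ⟨p, -, rfl⟩
      exact (Nat.succ_le_of_lt p.1.2).trans_lt h.order_lt) (by simpa using hb)
  obtain ⟨d, hd, hdd⟩ := I.exists_digit_eq h.base_le (P.toList.map idx) (by
      simp only [List.mem_map, Finset.mem_toList]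
      rintro _ ⟨p, hp, rfl⟩
      exact (hidx p hp).1) (by simpa using hb)
  have hlen : P.toList.length < I.bound := by
    rw [Finset.length_toList]
    exact (Nat.lt_pow_self (by simp [base])).trans_le hb
  have hdig : ∀ (j : ℕ) (hj : j < P.toList.length),
      I.digit c j = P.toList[j].1 + 1 ∧ I.digit d j = idx P.toList[j] := by
    intro j hj
    rw [hdc j (by omega), hdd j (by omega), List.getD_eq_getElem _ _ (by simpa using hj),
      List.getD_eq_getElem _ _ (by simpa using hj)]
    simp
  have hpos : ∀ j < I.bound, 0 < I.digit c j → j < P.toList.length := by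
    intro j hj h₀
    by_contra hj'
    rw [hdc j hj.le, List.getD_eq_default _ _ (by simpa using hj')] at h₀
    exact lt_irrefl _ h₀
  refine ⟨c, hc, d, hd, ?_, fun j hj h₀ => ?_⟩
  · ext ⟨x, τ⟩
    constructor
    · rintro ⟨j, hj, h₁, h₂⟩
      have hjl := hpos j hj (by simp [h₁])
      obtain ⟨h₃, h₄⟩ := hdig j hjl
      have hmem : P.toList[j] ∈ P := Finset.mem_toList.1 (List.getElem_mem hjl)
      rw [h₄, (hidx _ hmem).2] at h₂
      have h₅ : P.toList[j].1 = x := Fin.ext (by simp only at h₁; omega)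
      have h₆ : P.toList[j] = (x, τ) := Prod.ext h₅ h₂
      exact h₆ ▸ hmem
    · intro hp
      obtain ⟨j, hj, hjp⟩ := List.getElem_of_mem (Finset.mem_toList.2 (Finset.mem_coe.1 hp))
      obtain ⟨h₃, h₄⟩ := hdig j hj
      rw [hjp] at h₃ h₄
      exact ⟨j, by omega, h₃, by rw [h₄, (hidx _ hp).2]⟩
  · rw [(hdig j (hpos j hj h₀)).1, Nat.add_sub_cancel]
    exact Fin.is_lt _

theorem exists_core_eq (h : I.Represents m G ed) {F : Finset (Sym2 (Fin n) × ℕ)} (hF : F ⊆ G)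
    (hb : I.base ^ F.card ≤ I.bound) : ∃ f < I.bound, I.core m ed f = F := by
  have hbase' : m < I.base := by simp only [base, h.len]; omega
  have hidx : ∀ g, ∃ e, g ∈ F → e < m ∧ ed e = g := fun g => by
    by_cases hg : g ∈ F
    · obtain ⟨e, he⟩ := h.surj g (hF hg)
      exact ⟨e, fun _ => he⟩
    · exact ⟨0, fun h => absurd h hg⟩
  choose idx hidx using hidx
  obtain ⟨f, hf, hdf⟩ := I.exists_digit_eq h.base_le (F.toList.map fun g => idx g + 1) (by
      simp only [List.mem_map, Finset.mem_toList]
      rintro _ ⟨g, hg, rfl⟩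
      have := (hidx g hg).1
      simp only [base, h.len]
      omega) (by simpa using hb)
  have hlen : F.toList.length < I.bound := by
    rw [Finset.length_toList]
    exact (Nat.lt_pow_self (by simp [base])).trans_le hb
  refine ⟨f, hf, ?_⟩
  ext g
  rw [mem_core]
  constructor
  · rintro ⟨e, he, ⟨j, hj, h₁⟩, rfl⟩
    rw [hdf j hj.le] at h₁
    have hjl : j < F.toList.length := by
      by_contra hj'
      rw [List.getD_eq_default _ _ (by simpa using hj')] at h₁
      omega
    rw [List.getD_eq_getElem _ _ (by simpa using hjl), List.getElem_map] at h₁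
    have hmem : F.toList[j] ∈ F := Finset.mem_toList.1 (List.getElem_mem hjl)
    obtain rfl : idx F.toList[j] = e := by omega
    rw [(hidx _ hmem).2]
    exact hmem
  · intro hg
    obtain ⟨j, hj, hjg⟩ := List.getElem_of_mem (Finset.mem_toList.2 hg)
    refine ⟨idx g, (hidx g hg).1, ⟨j, by omega, ?_⟩, (hidx g hg).2⟩
    rw [hdf j (by omega), List.getD_eq_getElem _ _ (by simpa using hj), List.getElem_map, hjg]

/-- If there is a small spanner, then the search succeeds. -/
theorem accepts_of_connects (h : I.Represents m G ed) (hG : ProperEdges G) (hn : 2 ≤ n)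
    {X : Finset (Fin n)} (hX : ∀ a b l, (s(a, b), l) ∈ G → a ∈ X ∨ b ∈ X)
    (hb : I.base ^ (4 * (X.card + 1) ^ 2) ≤ I.bound) {E : Finset (Sym2 (Fin n) × ℕ)} (hEG : E ⊆ G)
    (hE : Connects E) (hcard : E.card ≤ I.arr 2) : I.Accepts := by
  have : Nontrivial (Fin n) := Fin.nontrivial_iff_two_le.2 hn
  obtain ⟨F, P, Q, hF, hP, hQ, hPl, hQl, hFE, hlink, hout, hin, hsize⟩ :=
    hE.exists_core hEG hG hX
  -- The exponent leaves room for the `4|X|²` edges of the core, the `2|X|` points of each list and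
  -- the `2|X| + 1` vertices of a route.
  have hpow : ∀ k, k ≤ 4 * (X.card + 1) ^ 2 → I.base ^ k ≤ I.bound := fun k hk =>
    (Nat.pow_le_pow_right (by simp [base]) hk).trans hb
  obtain ⟨f, hf, rfl⟩ := h.exists_core_eq (hFE.trans hEG) (hpow _ (by nlinarith))
  obtain ⟨c, hc, d, hd, hcd, hcn⟩ := h.exists_points_eq P
    (fun x τ hx => (hPl x τ hx).imp_right fun ⟨e, he⟩ => ⟨e, hEG he⟩) (hpow _ (by nlinarith))
  obtain ⟨c', hc', d', hd', hcd', hcn'⟩ := h.exists_points_eq Q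
    (fun x τ hx => .inr ((hQl x τ hx).imp fun e he => hEG he)) (hpow _ (by nlinarith))
  refine .inr ⟨f, hf, c, hc, d, hd, c', hc', d', hd', ?_, ?_, ?_⟩
  · intro j hj j' hj' h₀ h₀'
    have hp : ((⟨_, hcn j hj h₀⟩, I.label (I.digit d j)) : Fin n × ℕ) ∈ I.points n c d :=
      ⟨j, hj, by simp only; omega, rfl⟩
    have hq : ((⟨_, hcn' j' hj' h₀'⟩, I.label (I.digit d' j')) : Fin n × ℕ) ∈ I.points n c' d' :=
      ⟨j', hj', by simp only; omega, rfl⟩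
    rw [hcd] at hp
    rw [hcd'] at hq
    obtain ⟨hτ, s, k, J, hs, hk⟩ := hlink _ _ _ _ hp hq
    exact h.linked_of_journey (hpow _ (by nlinarith)) hτ J hs
  · intro v _ hv
    rw [h.order] at hv
    refine ⟨(h.outAll_iff ⟨v, hv⟩).2 ?_, (h.inAll_iff ⟨v, hv⟩).2 ?_⟩
    · rw [hcd]
      exact hout _
    · rw [hcd']
      exact hin _
  · rw [h.spannerSize_eq, hcd, hcd']
    exact hsize.trans hcard

theorem hasCover_iff (h : I.Represents m G ed) (hb : I.base ^ I.level ≤ I.bound) :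
    I.HasCover ↔ ∃ X : Finset (Fin n), X.card ≤ I.level ∧
      ∀ a b l, (s(a, b), l) ∈ G → a ∈ X ∨ b ∈ X := by
  classical
  have hlev : I.level < I.bound := (Nat.lt_pow_self (by simp [base])).trans_le hb
  have hsrc : ∀ e < m, I.src e < n ∧ I.tgt e < n := fun e he =>
    h.joins_lt e he _ _ (.inl ⟨rfl, rfl⟩)
  constructor
  · rintro ⟨c, hc, H⟩
    -- Only the first `I.level` digits count, so any code yields at most that many vertices.
    refine ⟨Finset.univ.filter fun v => ∃ j < I.level, I.digit c j = v, ?_, fun a b l hab => ?_⟩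
    · rw [← Finset.card_map Fin.valEmbedding]
      refine (Finset.card_le_card ?_).trans
        ((Finset.card_image_le (s := Finset.range I.level) (f := I.digit c)).trans (by simp))
      intro v hv
      simp only [Finset.mem_map, Finset.mem_filter, Finset.mem_univ, true_and] at hv
      obtain ⟨v, ⟨j, hj, hjv⟩, rfl⟩ := hv
      exact Finset.mem_image.2 ⟨j, Finset.mem_range.2 hj, hjv⟩
    · obtain ⟨e, he, hed⟩ := h.surj _ hab
      obtain ⟨j, -, hj, hje⟩ := H e (he.trans h.size_lt_bound) (h.isEdge_iff.2 he)
      simp only [Finset.mem_filter, Finset.mem_univ, true_and]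
      rcases (h.joins e he a b).2 (by rw [hed]) with ⟨h₁, h₂⟩ | ⟨h₁, h₂⟩ <;>
        rcases hje with hje | hje
      · exact .inl ⟨j, hj, hje.trans h₁⟩
      · exact .inr ⟨j, hj, hje.trans h₂⟩
      · exact .inr ⟨j, hj, hje.trans h₁⟩
      · exact .inl ⟨j, hj, hje.trans h₂⟩
  · rintro ⟨X, hXc, hX⟩
    obtain ⟨c, hc, hdc⟩ := I.exists_digit_eq h.base_le (X.toList.map fun v : Fin n => (v : ℕ)) (by
      simp only [List.mem_map]
      rintro _ ⟨v, -, rfl⟩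
      exact v.2.trans h.order_lt)
      (by simpa using (Nat.pow_le_pow_right (by simp [base]) hXc).trans hb)
    have hdig : ∀ v ∈ X, ∃ j < I.level, I.digit c j = v := by
      intro v hv
      obtain ⟨j, hj, hjv⟩ := List.getElem_of_mem (Finset.mem_toList.2 hv)
      have hj' := hj
      rw [Finset.length_toList] at hj'
      refine ⟨j, by omega, ?_⟩
      rw [hdc j (by omega), List.getD_eq_getElem _ _ (by simpa using hj), List.getElem_map, hjv]
    refine ⟨c, hc, fun e _ he => ?_⟩
    rw [h.isEdge_iff] at he
    obtain ⟨h₁, h₂⟩ := hsrc e he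
    have hed : (ed e).1 = s(⟨_, h₁⟩, ⟨_, h₂⟩) := (h.joins e he _ _).1 (.inl ⟨rfl, rfl⟩)
    rcases hX ⟨_, h₁⟩ ⟨_, h₂⟩ (ed e).2 (by rw [← hed]; exact h.mem e he) with hx | hx
    · obtain ⟨j, hj, hjv⟩ := hdig _ hx
      exact ⟨j, by omega, hj, .inl hjv⟩
    · obtain ⟨j, hj, hjv⟩ := hdig _ hx
      exact ⟨j, by omega, hj, .inr hjv⟩

end Represents

end RamInput

/-! ### The program -/

/-- Moves a result to a fixed place, so that the main program can use variable `1` for the bound,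
`2` for the level, `3` as loop flag and `0` for the length and finally the answer. -/
theorem Easy.exists_assign {g : RamInput → ℕ} (hg : Easy g) (x : ℕ) :
    ∃ (p : RamProg) (c : ℕ), ∀ σ : RamState, ∃ (σ' : RamState) (t : ℕ), RamExec p σ σ' t ∧
      t ≤ polyTime c (σ.var 1) ∧ σ'.var x = g σ.input ∧ σ'.arr = σ.arr ∧
        ∀ i < 3, i ≠ x → σ'.var i = σ.var i := by
  obtain ⟨p, c, r, _, hr, ⟨j, hj, rfl⟩, H⟩ := hg 3 RamState.input le_rfl rfl
  refine ⟨.seq p (.assign x (.var j)), c + 2, fun σ => ?_⟩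
  obtain ⟨σ', t, e, ht, k, v⟩ := H σ
  refine ⟨_, _, .seq e (.assign ..), ?_, ?_, k.1, fun i hi hix => ?_⟩
  · have := polyTime_add_le c 2 (σ.var 1)
    have := le_polyTime 2 (σ.var 1)
    simp only [RamExpr.cost]
    omega
  · simp only [RamState.setVar_var_self]
    exact v
  · rw [RamState.setVar_var_of_ne _ _ hix, k.2 i hi]

/-- The input data when the vertex covers of size `D` are searched. -/
def searchInput (w : List ℕ) (D : ℕ) : RamInput where
  arr i := w.getD i 0
  len := w.length
  bound := (w.length + 2) ^ (4 * (D + 1) ^ 2)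
  level := D

theorem base_le_bound_searchInput (w : List ℕ) (D : ℕ) :
    (searchInput w D).base ≤ (searchInput w D).bound :=
  Nat.le_self_pow (by positivity) _

set_option maxHeartbeats 1000000 in
/-- One program finds the size of a smallest vertex cover, and then searches for a core. -/
theorem exists_search_program : ∃ (p : RamProg) (c : ℕ), ∀ (w : List ℕ) (d : ℕ),
    (∀ D < d, ¬ (searchInput w D).HasCover) → (searchInput w d).HasCover →
      ∃ (σ : RamState) (t : ℕ), RamExec p (ramInit w) σ t ∧
        t ≤ polyTime c ((w.length + 2) ^ (4 * (d + 1) ^ 2)) ∧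
        σ.var 0 = indicator (searchInput w d).Accepts := by
  obtain ⟨p₀, c₀, H₀⟩ := Easy.exists_assign (g := fun I => I.mulPow I.base 3)
    (Easy.mulPow .id (Easy.base .id) (.const 3)) 1
  obtain ⟨p₁, c₁, H₁⟩ := Easy.exists_assign (EasyPred.hasCover .id).not 3
  -- Since `4(D+2)² - 4(D+1)² = 8D + 12`, this turns the bound for `D` into the bound for `D + 1`;
  -- the multiple `8D` is formed by additions.
  obtain ⟨p₂, c₂, H₂⟩ := Easy.exists_assign
    (g := fun I => I.mulPow I.bound (12 + (I.level + I.level + (I.level + I.level) +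
      (I.level + I.level + (I.level + I.level)))))
    (Easy.mulPow .id (Easy.bound .id) (.add (.const 12)
      (.add (.add (.add (Easy.level .id) (Easy.level .id)) (.add (Easy.level .id) (Easy.level .id)))
      (.add (.add (Easy.level .id) (Easy.level .id)) (.add (Easy.level .id) (Easy.level .id)))))) 1
  obtain ⟨p₃, c₃, H₃⟩ := Easy.exists_assign (EasyPred.accepts .id) 0
  refine ⟨.seq (.assign 1 (.plus (.var 0) (.const 3))) (.seq p₀ (.seq p₁
      (.seq (.loop (.var 3) (.seq p₂ (.seq (.assign 2 (.plus (.var 2) (.const 1))) p₁))) p₃))),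
    4 + c₀ + c₁ + (c₂ + c₁ + 10 + 1) + 2 + c₃, fun w d hlt hd => ?_⟩
  set b := w.length + 2 with hb
  set M := b ^ (4 * (d + 1) ^ 2) with hM
  have hb2 : 2 ≤ b := by omega
  have hmono : ∀ D ≤ d, b ^ (4 * (D + 1) ^ 2) ≤ M := fun D hD =>
    Nat.pow_le_pow_right (by omega) (by gcongr)
  have hbM : b + 1 ≤ M := calc
    b + 1 ≤ b ^ 2 := by nlinarith
    _ ≤ M := Nat.pow_le_pow_right (by omega) (by
      have := Nat.le_self_pow two_ne_zero (d + 1)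
      omega)
  have harr : (ramInit w).arr 0 = fun i => w.getD i 0 := by
    funext i
    simp [ramInit]
  have hinp : ∀ (σ : RamState) (D : ℕ), σ.arr = (ramInit w).arr → σ.var 0 = w.length →
      σ.var 1 = b ^ (4 * (D + 1) ^ 2) → σ.var 2 = D → σ.input = searchInput w D := by
    intro σ D h₁ h₂ h₃ h₄
    simp only [RamState.input, h₁, h₂, h₃, h₄, harr, searchInput, hb]
  -- The provisional bound `b + 1` is at least `b` and at least `3`, which is what computing `b * b
  -- ^ 3`, the bound for `D = 0`, requires.
  set σ₁ := (ramInit w).setVar 1 (w.length + 3) with hσ₁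
  have e₁ : RamExec (.assign 1 (.plus (.var 0) (.const 3))) (ramInit w) σ₁ 4 := .assign ..
  have hσ₁0 : σ₁.var 0 = w.length := by simp [hσ₁, RamState.setVar, ramInit]
  have hσ₁1 : σ₁.var 1 = b + 1 := by simp [hσ₁, hb]
  have hσ₁2 : σ₁.var 2 = 0 := by simp [hσ₁, RamState.setVar, ramInit]
  obtain ⟨σ₂, t₂, e₂, ht₂, v₂, a₂, k₂⟩ := H₀ σ₁
  have hσ₂1 : σ₂.var 1 = b ^ (4 * (0 + 1) ^ 2) := by
    have hI : σ₁.input.base = b := by simp [RamInput.base, RamState.input, hσ₁0, hb]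
    have hI' : σ₁.input.bound = b + 1 := by simp [RamState.input, hσ₁1]
    rw [v₂, RamInput.mulPow_eq (by omega) (by omega), hI]
    ring
  obtain ⟨σ₃, t₃, e₃, ht₃, v₃, a₃, k₃⟩ := H₁ σ₂
  have hσ₂i : σ₂.input = searchInput w 0 := hinp _ _ a₂ (by rw [k₂ 0 (by omega) (by omega), hσ₁0])
    hσ₂1 (by rw [k₂ 2 (by omega) (by omega), hσ₁2])
  obtain ⟨σ₄, t₄, e₄, ht₄, h₄⟩ := RamExec.exists_loop (e := .var 3)
    (p := .seq p₂ (.seq (.assign 2 (.plus (.var 2) (.const 1))) p₁)) d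
    (polyTime c₂ M + polyTime c₁ M + 4)
    (fun D σ => σ.arr = (ramInit w).arr ∧ σ.var 0 = w.length ∧ σ.var 1 = b ^ (4 * (D + 1) ^ 2) ∧
      σ.var 2 = D ∧ σ.var 3 = indicator (¬ (searchInput w D).HasCover))
    (by
      rintro D hD σ ⟨ha, h0, h1, h2, h3⟩
      refine ⟨?_, ?_⟩
      · simpa [RamExpr.eval, h3] using hlt D hD
      have hi := hinp σ D ha h0 h1 h2
      obtain ⟨τ₁, s₁, x₁, hs₁, w₁, b₁, l₁⟩ := H₂ σ
      set τ₂ := τ₁.setVar 2 (τ₁.var 2 + 1) with hτ₂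
      obtain ⟨τ₃, s₃, x₃, hs₃, w₃, b₃, l₃⟩ := H₁ τ₂
      have hτ₂0 : τ₂.var 0 = w.length := by
        rw [hτ₂, RamState.setVar_var_of_ne _ _ (by omega), l₁ 0 (by omega) (by omega), h0]
      have hτ₂1 : τ₂.var 1 = b ^ (4 * (D + 1 + 1) ^ 2) := by
        have hbase := base_le_bound_searchInput w D
        rw [hτ₂, RamState.setVar_var_of_ne _ _ (by omega), w₁, hi, RamInput.mulPow_eq hbase]
        · simp only [searchInput, RamInput.base, ← hb, ← pow_add]
          congr 1
          ring
        -- `mulPow` is correct only if its exponent `8D + 12` does not exceed the current bound.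
        · have h16 : D + 1 ≤ 16 ^ D := Nat.lt_pow_self (by omega)
          have hle : 16 ^ (D + 1) ≤ b ^ (4 * (D + 1) ^ 2) := calc
            16 ^ (D + 1) = 2 ^ (4 * (D + 1)) := by rw [pow_mul]; norm_num
            _ ≤ b ^ (4 * (D + 1)) := Nat.pow_le_pow_left hb2 _
            _ ≤ _ := Nat.pow_le_pow_right (by omega) (by nlinarith)
          rw [pow_succ] at hle
          simp only [searchInput, ← hb]
          omega
      have hτ₂2 : τ₂.var 2 = D + 1 := by
        rw [hτ₂, RamState.setVar_var_self, l₁ 2 (by omega) (by omega), h2]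
      refine ⟨τ₃, _, .seq x₁ (.seq (.assign ..) x₃), ?_, b₃.trans (b₁.trans ha),
        by rw [l₃ 0 (by omega) (by omega), hτ₂0], by rw [l₃ 1 (by omega) (by omega), hτ₂1],
        by rw [l₃ 2 (by omega) (by omega), hτ₂2], ?_⟩
      · rw [h1] at hs₁
        rw [hτ₂1] at hs₃
        have := hs₁.trans (polyTime_mono_right c₂ (hmono D hD.le))
        have := hs₃.trans (polyTime_mono_right c₁ (hmono (D + 1) hD))
        simp only [RamExpr.cost]
        omega
      · rw [w₃, hinp τ₂ (D + 1) (b₁.trans ha) hτ₂0 hτ₂1 hτ₂2])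
    (by
      rintro σ ⟨-, -, -, -, h3⟩
      simpa [RamExpr.eval, h3] using hd)
    (σ := σ₃) ⟨a₃.trans a₂, by
      rw [k₃ 0 (by omega) (by omega), k₂ 0 (by omega) (by omega), hσ₁0], by
      rw [k₃ 1 (by omega) (by omega), hσ₂1], by
      rw [k₃ 2 (by omega) (by omega), k₂ 2 (by omega) (by omega), hσ₁2], by
      rw [v₃, hσ₂i]⟩
  obtain ⟨σ₅, t₅, e₅, ht₅, v₅, -, -⟩ := H₃ σ₄
  refine ⟨σ₅, _, .seq e₁ (.seq e₂ (.seq e₃ (.seq e₄ e₅))), ?_, ?_⟩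
  · rw [hσ₁1] at ht₂
    rw [hσ₂1] at ht₃
    rw [h₄.2.2.1, ← hM] at ht₅
    have := ht₂.trans (polyTime_mono_right c₀ hbM)
    have := ht₃.trans (polyTime_mono_right c₁ (hmono 0 (by omega)))
    have hdM : d ≤ M := by
      have h₁ : 4 * (d + 1) ^ 2 < M := Nat.lt_pow_self (by omega)
      have h₂ := Nat.le_self_pow two_ne_zero (d + 1)
      omega
    have h₁ : d * (polyTime c₂ M + polyTime c₁ M + 4 + (RamExpr.var 3).cost + 1) ≤
        M * polyTime (c₂ + c₁ + 10) M := Nat.mul_le_mul hdM (by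
      have := polyTime_add_le c₂ c₁ M
      have := polyTime_add_le (c₂ + c₁) 10 M
      have := le_polyTime 10 M
      simp only [RamExpr.cost]
      omega)
    have h₂ := mul_polyTime_le (c₂ + c₁ + 10) M
    have h₃ := polyTime_add_le 4 c₀ M
    have h₄ := polyTime_add_le (4 + c₀) c₁ M
    have h₅ := polyTime_add_le (4 + c₀ + c₁) (c₂ + c₁ + 10 + 1) M
    have h₆ := polyTime_add_le (4 + c₀ + c₁ + (c₂ + c₁ + 10 + 1)) 2 M
    have h₇ := polyTime_add_le (4 + c₀ + c₁ + (c₂ + c₁ + 10 + 1) + 2) c₃ M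
    have h₈ := le_polyTime 4 M
    have h₉ := le_polyTime 2 M
    simp only [RamExpr.cost] at ht₄ h₁
    omega
  · obtain ⟨h₁, h₂, h₃, h₄, -⟩ := h₄
    rw [v₅, hinp σ₄ d h₁ h₂ h₃ h₄]

/-! ### Instances -/

theorem getD_flatMap_triple {α : Type} (f g h : α → ℕ) (l : List α) (i : ℕ) (hi : i < l.length) :
    (l.flatMap fun a => [f a, g a, h a]).getD (i + (i + i)) 0 = f l[i] ∧
    (l.flatMap fun a => [f a, g a, h a]).getD (1 + (i + (i + i))) 0 = g l[i] ∧
    (l.flatMap fun a => [f a, g a, h a]).getD (2 + (i + (i + i))) 0 = h l[i] := by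
  induction l generalizing i with
  | nil => simp at hi
  | cons a l ih =>
    cases i with
    | zero => simp
    | succ i =>
      obtain ⟨h₁, h₂, h₃⟩ := ih i (by simpa using hi)
      rw [show i + 1 + (i + 1 + (i + 1)) = i + (i + i) + 1 + 1 + 1 by omega,
        show 1 + (i + (i + i) + 1 + 1 + 1) = 1 + (i + (i + i)) + 1 + 1 + 1 by omega,
        show 2 + (i + (i + i) + 1 + 1 + 1) = 2 + (i + (i + i)) + 1 + 1 + 1 by omega]
      simp only [List.flatMap_cons, List.cons_append, List.nil_append, List.getD_cons_succ,
        List.getElem_cons_succ]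
      exact ⟨h₁, h₂, h₃⟩

namespace HappyInstance

variable {κ : PathKind} (I : HappyInstance κ)

theorem connects : Connects I.graph.timeEdges :=
  (TemporalGraph.isTC_iff_connects I.happy.properEdges).1 I.connected

/-- The vertex cover number, in terms of time edges. -/
theorem vertexCoverNum_le_iff (D : ℕ) :
    I.graph.underlying.vertexCoverNum.toNat ≤ D ↔ ∃ X : Finset (Fin I.n), X.card ≤ D ∧
      ∀ a b l, (s(a, b), l) ∈ I.graph.timeEdges → a ∈ X ∨ b ∈ X := by
  classical
  have hfin : I.graph.underlying.vertexCoverNum ≠ ⊤ := SimpleGraph.vertexCoverNum_ne_top_of_finite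
  constructor
  · intro h
    obtain ⟨s, hs, hc⟩ := SimpleGraph.vertexCoverNum_exists I.graph.underlying
    refine ⟨s.toFinset, ?_, fun a b l hab => ?_⟩
    · rw [Set.encard_eq_coe_toFinset_card] at hs
      rw [← hs] at h
      simpa using h
    · simpa using hc ⟨l, hab⟩
  · rintro ⟨X, hX, hc⟩
    have h := SimpleGraph.IsVertexCover.vertexCoverNum_le (G := I.graph.underlying)
      (c := (X : Set _)) fun a b ⟨l, hab⟩ => by simpa using hc a b l hab
    rw [Set.encard_coe_eq_coe_finsetCard, ← ENat.natCast_toNat hfin] at h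
    exact (Nat.cast_le.1 h).trans hX

variable {I}

/-- The size of a representation. -/
theorem Encodes.length_eq {w : List ℕ} (h : I.Encodes w) :
    ∃ m, w.length = 3 * m + 3 ∧ m ≤ I.n * I.n ∧ (2 ≤ I.n → I.n ≤ 2 * m) := by
  obtain ⟨es, hnd, hmem, rfl⟩ := h
  refine ⟨es.length, by simp; omega, ?_, fun hn => ?_⟩
  -- An edge has only one label, so the listed time edges have distinct endpoint pairs.
  · have hinj : (es.map fun e => (e.1, e.2.1)).Nodup := by
      refine List.Nodup.map_on ?_ hnd.of_map
      rintro ⟨u, v, t⟩ h₁ ⟨u', v', t'⟩ h₂ h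
      obtain ⟨rfl, rfl⟩ := Prod.mk.inj h
      have := I.happy.1 s(u, v) t t' ((hmem _ _).2 (List.mem_map.2 ⟨_, h₁, rfl⟩))
        ((hmem _ _).2 (List.mem_map.2 ⟨_, h₂, rfl⟩))
      rw [this]
    simpa using hinj.length_le_card
  · have : Nontrivial (Fin I.n) := Fin.nontrivial_iff_two_le.2 hn
    have hsub : (Finset.univ : Finset (Fin I.n)) ⊆
        (es.flatMap fun e => [e.1, e.2.1]).toFinset := by
      intro v _
      obtain ⟨z, t, hz⟩ := I.connects.exists_edge v
      obtain ⟨e, he, hez⟩ := List.mem_map.1 ((hmem _ _).1 hz)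
      have h₁ : s(e.1, e.2.1) = s(v, z) := congrArg Prod.fst hez
      have hv : v ∈ s(e.1, e.2.1) := h₁ ▸ Sym2.mem_mk_left v z
      rw [List.mem_toFinset, List.mem_flatMap]
      exact ⟨e, he, by simpa using hv⟩
    have := (Finset.card_le_card hsub).trans (List.toFinset_card_le _)
    simpa [mul_comm] using this

/-- With two vertices, each vertex lies on an edge, so `n ≤ 2m` and even the shifted vertices are
digits. -/
theorem Encodes.represents {w : List ℕ} (h : I.Encodes w) (hn : 2 ≤ I.n) (D : ℕ) :
    ∃ m ed, (searchInput w D).Represents m I.graph.timeEdges ed ∧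
      (searchInput w D).arr 2 = I.k := by
  obtain ⟨m, hm, -, hnm⟩ := h.length_eq
  obtain ⟨es, hnd, hmem, rfl⟩ := h
  have hlen : es.length = m := by simp at hm; omega
  have : Nontrivial (Fin I.n) := Fin.nontrivial_iff_two_le.2 hn
  obtain ⟨v₀⟩ : Nonempty (Fin I.n) := inferInstance
  set w := I.n :: I.graph.maxLabel :: I.k :: es.flatMap fun e => [(e.1 : ℕ), (e.2.1 : ℕ), e.2.2]
    with hw
  let L := es.map fun e => (s(e.1, e.2.1), e.2.2)
  have hLlen : L.length = m := by simp [L, hlen]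
  have hL : ∀ (e : ℕ) (he : e < es.length), L.getD e (s(v₀, v₀), 0) =
      (s(es[e].1, es[e].2.1), es[e].2.2) := fun e he => by
    rw [List.getD_eq_getElem _ _ (by simpa [L] using he)]
    simp [L]
  have hval : ∀ (e : ℕ) (he : e < es.length), (searchInput w D).src e = es[e].1 ∧
      (searchInput w D).tgt e = es[e].2.1 ∧ (searchInput w D).label e = es[e].2.2 := by
    intro e he
    have := getD_flatMap_triple (fun e : Fin I.n × Fin I.n × ℕ => (e.1 : ℕ))
      (fun e => (e.2.1 : ℕ)) (fun e => e.2.2) es e he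
    simp only [RamInput.src, RamInput.tgt, RamInput.label, searchInput, hw]
    rw [show 3 + (e + (e + e)) = e + (e + e) + 1 + 1 + 1 by omega,
      show 4 + (e + (e + e)) = 1 + (e + (e + e)) + 1 + 1 + 1 by omega,
      show 5 + (e + (e + e)) = 2 + (e + (e + e)) + 1 + 1 + 1 by omega]
    simpa only [List.getD_cons_succ] using this
  refine ⟨m, fun e => L.getD e (s(v₀, v₀), 0), ?_, rfl⟩
  refine ⟨rfl, hm, fun e he => ?_, fun g hg => ?_, fun e he e' he' hee => ?_, fun e he => ?_,
    fun e he u v => ?_, fun e he a b hab => ?_, ?_, ?_, base_le_bound_searchInput _ _⟩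
  · rw [← hLlen] at he
    simp only [List.getD_eq_getElem _ _ he]
    exact (hmem _ _).2 (List.getElem_mem he)
  · obtain ⟨e, he, hge⟩ := List.getElem_of_mem ((hmem g.1 g.2).1 hg)
    exact ⟨e, hLlen ▸ he, by rw [List.getD_eq_getElem _ _ he]; exact hge⟩
  · rw [← hLlen] at he he'
    simp only [List.getD_eq_getElem _ _ he, List.getD_eq_getElem _ _ he'] at hee
    exact (List.Nodup.getElem_inj_iff hnd).1 hee
  · rw [← hlen] at he
    simp only [hL e he, (hval e he).2.2]
  · rw [← hlen] at he
    obtain ⟨h₁, h₂, -⟩ := hval e he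
    simp only [RamInput.Joins, h₁, h₂, hL e he, Sym2.eq_iff, Fin.val_inj]
  · rw [← hlen] at he
    obtain ⟨h₁, h₂, -⟩ := hval e he
    rcases hab with ⟨rfl, rfl⟩ | ⟨rfl, rfl⟩ <;> rw [h₁, h₂] <;> exact ⟨Fin.is_lt _, Fin.is_lt _⟩
  · exact List.getD_eq_default _ _ (by omega)
  · have := hnm hn
    simp only [RamInput.base, searchInput]
    omega

/-- The search is correct. -/
theorem Encodes.search {w : List ℕ} (h : I.Encodes w) :
    (∀ D < I.graph.underlying.vertexCoverNum.toNat, ¬ (searchInput w D).HasCover) ∧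
    (searchInput w I.graph.underlying.vertexCoverNum.toNat).HasCover ∧
    ((searchInput w I.graph.underlying.vertexCoverNum.toNat).Accepts ↔ I.HasSmallSpanner) := by
  set d := I.graph.underlying.vertexCoverNum.toNat with hd
  by_cases hn : 2 ≤ I.n
  · have hcover : ∀ D, (searchInput w D).HasCover ↔ d ≤ D := by
      intro D
      obtain ⟨m, ed, hR, -⟩ := h.represents hn D
      rw [hR.hasCover_iff, hd, I.vertexCoverNum_le_iff]
      · rfl
      · exact Nat.pow_le_pow_right (by simp [RamInput.base]) (by
          have := Nat.le_self_pow two_ne_zero (D + 1)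
          simp only [searchInput]
          omega)
    refine ⟨fun D hD => by rw [hcover]; omega, (hcover d).2 le_rfl, ?_⟩
    obtain ⟨m, ed, hR, hk⟩ := h.represents hn d
    rw [hasSmallSpanner_iff, ← hk]
    refine ⟨hR.exists_connects_of_accepts I.happy.properEdges hn, fun ⟨E, hE, hc, hcard⟩ => ?_⟩
    obtain ⟨X, hXd, hX⟩ := (I.vertexCoverNum_le_iff d).1 le_rfl
    refine hR.accepts_of_connects I.happy.properEdges hn hX ?_ hE hc hcard
    exact Nat.pow_le_pow_right (by simp [RamInput.base]) (by gcongr)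
  -- With at most one vertex there are no edges, the empty cover works, and the empty set of time
  -- edges is a spanner.
  · have hsub : Subsingleton (Fin I.n) := Fin.subsingleton_iff_le_one.2 (by omega)
    have hd0 : d = 0 := by simp [hd]
    have hm : w.length = 3 := by
      obtain ⟨es, -, hmem, rfl⟩ := h
      obtain rfl : es = [] := List.eq_nil_iff_forall_not_mem.2 fun e he =>
        I.graph.not_isDiag _ _ ((hmem _ _).2 (List.mem_map.2 ⟨e, he, rfl⟩))
          (Sym2.mk_isDiag_iff.2 (Subsingleton.elim _ _))
      rfl
    refine ⟨by simp [hd0], ⟨0, by simp [searchInput], fun e _ he => ?_⟩, iff_of_true (.inl ?_) ?_⟩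
    · simp only [RamInput.IsEdge, searchInput, hm] at he
      omega
    · obtain ⟨es, -, -, rfl⟩ := h
      simp only [searchInput, List.getD_cons_zero]
      omega
    · rw [hasSmallSpanner_iff]
      exact ⟨∅, by simp, fun u v => Subsingleton.elim u v ▸ ⟨_, _, .refl⟩, by simp⟩

end HappyInstance

/-! ### Running time in terms of `n` and of the bit size -/

theorem length_le_bitSize (w : List ℕ) : w.length ≤ bitSize w := by
  induction w with
  | nil => simp
  | cons a w ih =>
    simp only [bitSize, List.map_cons, List.sum_cons, List.length_cons] at ih ⊢
    omega

/-- The running time of the search in terms of the number of vertices. -/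
theorem polyTime_search_le (c : ℕ) : ∃ C, ∀ n m d : ℕ, m ≤ n * n → (2 ≤ n → 1 ≤ d) →
    (n < 2 → m = 0 ∧ d = 0) →
      polyTime c ((3 * m + 3 + 2) ^ (4 * (d + 1) ^ 2)) ≤ C * n ^ (C * d ^ 2) := by
  -- The number `625 = 5 ^ 4` is the loop bound for `m = d = 0`, where the exponent vanishes and `C`
  -- alone must suffice. The `81` is `80` from `20 (d + 1)² ≤ 80 d²`, plus one factor `n` to absorb
  -- the `+ 1` in `polyTime`.
  refine ⟨81 * c + polyTime c 625, fun n m d hm hd hn => ?_⟩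
  by_cases h2 : 2 ≤ n
  · have hd := hd h2
    have h₁ : 3 * m + 3 + 2 ≤ n ^ 5 := by
      have h₃ : n ^ 5 = n * n * (n * n * n) := by ring
      have h₄ : 2 * 2 * 2 ≤ n * n * n := by gcongr
      have h₅ : 2 * 2 ≤ n * n := by gcongr
      nlinarith
    have h₂ : (3 * m + 3 + 2) ^ (4 * (d + 1) ^ 2) + 1 ≤ n ^ (81 * d ^ 2) := calc
      (3 * m + 3 + 2) ^ (4 * (d + 1) ^ 2) + 1 ≤ (n ^ 5) ^ (4 * (d + 1) ^ 2) + 1 := by gcongr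
      _ = n ^ (20 * (d + 1) ^ 2) + 1 := by rw [← pow_mul]; congr 2; ring
      _ ≤ n ^ (80 * d ^ 2) + 1 :=
        Nat.add_le_add_right (Nat.pow_le_pow_right (by omega) (by nlinarith)) 1
      _ ≤ n ^ (80 * d ^ 2) * n := by
        have : 1 ≤ n ^ (80 * d ^ 2) := Nat.one_le_pow _ _ (by omega)
        nlinarith
      _ = n ^ (80 * d ^ 2 + 1) := (pow_succ _ _).symm
      _ ≤ n ^ (81 * d ^ 2) := Nat.pow_le_pow_right (by omega) (by nlinarith)
    calc polyTime c ((3 * m + 3 + 2) ^ (4 * (d + 1) ^ 2))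
        ≤ c * (n ^ (81 * d ^ 2)) ^ c := Nat.mul_le_mul_left _ (Nat.pow_le_pow_left h₂ _)
      _ = c * n ^ (81 * c * d ^ 2) := by rw [← pow_mul]; congr 2; ring
      _ ≤ _ := Nat.mul_le_mul (by omega) (Nat.pow_le_pow_right (by omega) (by gcongr; omega))
  · obtain ⟨rfl, rfl⟩ := hn (by omega)
    simp

/-- Minimum Temporal Spanner on happy temporal graphs (for strict and for non-strict temporal
paths) is in XP when parameterized by the vertex cover number `d` of the underlying graph, with
running time `n ^ O(d ^ 2)` on graphs with `n` vertices. -/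
theorem theorem2 (κ : PathKind) :
    (happyMinimumTemporalSpanner κ).InXP ∧
      ∃ C : ℕ, (happyMinimumTemporalSpanner κ).SolvableInTime fun (I : HappyInstance κ) _ =>
        C * I.n ^ (C * I.graph.underlying.vertexCoverNum.toNat ^ 2) := by
  obtain ⟨p, c, hp⟩ := exists_search_program
  obtain ⟨C, hC⟩ := polyTime_search_le c
  have H : ∀ (I : HappyInstance κ) (w : List ℕ), I.Encodes w →
      ∃ (σ : RamState) (t : ℕ), RamExec p (ramInit w) σ t ∧
        t ≤ C * I.n ^ (C * I.graph.underlying.vertexCoverNum.toNat ^ 2) ∧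
        (I.HasSmallSpanner → σ.var 0 = 1) ∧ (¬ I.HasSmallSpanner → σ.var 0 = 0) := by
    intro I w h
    obtain ⟨h₁, h₂, h₃⟩ := h.search
    obtain ⟨σ, t, e, ht, hσ⟩ := hp w _ h₁ h₂
    obtain ⟨m, hm, hmn, hnm⟩ := h.length_eq
    refine ⟨σ, t, e, ?_, fun hy => ?_, fun hn => ?_⟩
    · rw [hm] at ht
      refine ht.trans (hC _ m _ hmn (fun hn => ?_) fun hn => ?_)
      -- Two connected vertices force an edge, so `d` is positive.
      · by_contra hd
        obtain ⟨X, hX, hc⟩ := (I.vertexCoverNum_le_iff 0).1 (by omega)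
        obtain rfl := Finset.card_eq_zero.1 (Nat.le_zero.1 hX)
        have : Nontrivial (Fin I.n) := Fin.nontrivial_iff_two_le.2 hn
        obtain ⟨z, l, hz⟩ := I.connects.exists_edge ⟨0, by omega⟩
        simpa using hc _ _ _ hz
      · have hsub : Subsingleton (Fin I.n) := Fin.subsingleton_iff_le_one.2 (by omega)
        refine ⟨?_, by simp⟩
        obtain ⟨es, -, hmem, rfl⟩ := h
        obtain rfl : es = [] := List.eq_nil_iff_forall_not_mem.2 fun e he =>
          I.graph.not_isDiag _ _ ((hmem _ _).2 (List.mem_map.2 ⟨e, he, rfl⟩))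
            (Sym2.mk_isDiag_iff.2 (Subsingleton.elim _ _))
        simpa using hm
    · rw [hσ, indicator, if_pos (h₃.2 hy)]
    · rw [hσ, indicator, if_neg (h₃.not.2 hn)]
  -- The same function must dominate both the factor `C` and the exponent `C d²`.
  refine ⟨⟨fun d => C * (d * d) + C, ?_, p, fun I w h => ?_⟩, C, p, H⟩
  · exact (Primrec.nat_add.comp (Primrec.nat_mul.comp (Primrec.const C)
      (Primrec.nat_mul.comp Primrec.id Primrec.id)) (Primrec.const C)).to_comp
  · obtain ⟨σ, t, e, ht, hσ⟩ := H I w h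
    refine ⟨σ, t, e, ht.trans ?_, hσ⟩
    obtain ⟨m, hm, -, hnm⟩ := HappyInstance.Encodes.length_eq (I := I) h
    have hlen := length_le_bitSize w
    have hn : I.n ≤ bitSize w := by
      by_cases h2 : 2 ≤ I.n
      · have := hnm h2
        omega
      · omega
    refine Nat.mul_le_mul (Nat.le_add_left _ _) ((Nat.pow_le_pow_left hn _).trans
      (Nat.pow_le_pow_right (by omega) ?_))
    rw [sq]
    exact Nat.le_add_right _ _
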